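/- Let $H$ be a complex Hilbert space, $N\ge 2$, and let $M_1,\dots,M_N$ be closed subspaces of $H$ with intersection $M=M_1\cap\cdots\cap M_N$. Let $P_j$ and $P_M$ be the orthogonal projections of $H$ onto $M_j$ and $M$, and put $T=P_N\cdots P_2P_1$. Let $$c=c(M_1,\dots,M_N)=\sup\left\{\frac{2}{N-1}\,\frac{\sum_{j<k}\operatorname{Re}\langle m_j,m_k\rangle}{\|m_1\|^2+\cdots+\|m_N\|^2} : m_j\in M_j\cap M^{\perp},\ \|m_1\|^2+\cdots+\|m_N\|^2\ne 0\right\}$$ be the Friedrichs number (with $c=0$ if all the spaces $M_j\cap M^\perp$ are $\{0\}$). (i) If $c<1$, then $T^n\to P_M$ in operator norm, and $$\|T^n-P_M\|\le\left(1-\left(\frac{1-c}{4N}\right)^2\right)^{n/2}\qquad(n\ge 1).$$ (ii) If $c=1$, then $T^nx\to P_Mx$ for every $x\in H$, and convergence is arbitrarily slow in all of the following senses. - (ASC1) For every $\varepsilon>0$ and every sequence $(a_n)_{n\ge1}$ of positive numbers with $a_n\to0$ there is $x\in H$ with $\|x\|<\sup_n a_n+\varepsilon$ and $\|T^nx-P_Mx\|\ge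 a_n$ for all $n\ge1$. - (ASC2) For every sequence $(a_n)_{n\ge1}$ of positive numbers with $a_n\to0$, the set of $x\in H$ such that $\|T^nx-P_Mx\|\ge a_n$ for all but finitely many $n$ is dense in $H$. - (ASC3) For every sequence $(a_n)_{n\ge1}$ of positive numbers with $a_n\to0$ there are $x\in H$ and $y\in H^*$ with $\operatorname{Re}\langle T^nx-P_Mx,y\rangle\ge a_n$ for all $n\ge1$; furthermore, for the same $x$, whenever $Y$ is a complex Banach space and $H$ is linearly and isometrically embedded in $Y^*$, the vector $y$ can be chosen in $Y$ (with the pairing between $Y^*$ and $Y$). - (ASCH) For every $\varepsilon>0$ and every sequence $(a_n)_{n\ge1}$ of positive numbers with $a_n\to0$ there is $x\in H$ with $\|x\|<(\sup_n a_n)^{1/2}+\varepsilon$ and $\operatorname{Re}\langle T^nx-P_Mx,x\rangle\ge a_n$ for all $n\ge1$. - (ASCH for random products) For every $\varepsilon>0$, every sequence $(a_n)_{n\ge0}$ of positive numbers with $a_n\to0$, and every sequence of indices $(i_k)_{k\ge1}$ in $\{1,\dots,N\}$ there is $x\in H$ with $\|x\|<(\sup_n a_n)^{1/2}+\varepsilon$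 and $\operatorname{Re}\langle P_{i_n}\cdots P_{i_1}x-P_Mx,x\rangle>a_n$ for all $n\ge1$. -/

import Mathlib

open Filter Topology

universe u v

namespace AltProj

section Friedrichs

variable {H : Type u} [NormedAddCommGroup H] [InnerProductSpace ℂ H]

/-- The Friedrichs number `c(M_1, …, M_N)`. If all the subspaces `M_j ∩ Mᗮ` are zero, the set below
is empty and the value is `0`. -/
noncomputable def friedrichsNumber {N : ℕ} (M : Fin N → ClosedSubmodule ℂ H) : ℝ :=
  sSup {r : ℝ | ∃ m : Fin N → H,
    (∀ j, m j ∈ M j ∧ m j ∈ (⨅ i, M i)ᗮ) ∧ ∑ j, ‖m j‖ ^ 2 ≠ 0 ∧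
    r = 2 / ((N : ℝ) - 1) *
      ((∑ j, ∑ k ∈ Finset.Ioi j, (inner ℂ (m j) (m k)).re) / ∑ j, ‖m j‖ ^ 2)}

variable [CompleteSpace H]

/-- The orthogonal projection of `H` onto the closed subspace `S`. -/
noncomputable def proj (S : ClosedSubmodule ℂ H) : H →L[ℂ] H :=
  S.toSubmodule.starProjection

/-- The product `P_N ⋯ P_2 P_1` of the orthogonal projections onto `M_1, …, M_N`
(`P_1` is applied first). -/
noncomputable def cyclicProduct {N : ℕ} (M : Fin N → ClosedSubmodule ℂ H) : H →L[ℂ] H :=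
  (List.ofFn fun j => proj (M j)).reverse.prod

/-- The random product `P_{i_n} ⋯ P_{i_2} P_{i_1}`; the index `i_{k+1}` is `i k`. -/
noncomputable def randomProduct {N : ℕ} (M : Fin N → ClosedSubmodule ℂ H) (i : ℕ → Fin N) :
    ℕ → (H →L[ℂ] H)
  | 0 => 1
  | n + 1 => proj (M (i n)) * randomProduct M i n

end Friedrichs

section Banach

variable {X : Type u} [NormedAddCommGroup X] [NormedSpace ℂ X]

/-- Arbitrarily slow convergence of `T ^ n` to `Tinf`, variant 1. -/
def ASC1 (T Tinf : X →L[ℂ] X) : Prop :=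
  ∀ ε : ℝ, 0 < ε → ∀ a : ℕ+ → ℝ, (∀ n, 0 < a n) → Tendsto a atTop (𝓝 0) →
    ∃ x : X, ‖x‖ < (⨆ n, a n) + ε ∧ ∀ n : ℕ+, a n ≤ ‖(T ^ (n : ℕ)) x - Tinf x‖

/-- Arbitrarily slow convergence of `T ^ n` to `Tinf`, variant 2. -/
def ASC2 (T Tinf : X →L[ℂ] X) : Prop :=
  ∀ a : ℕ+ → ℝ, (∀ n, 0 < a n) → Tendsto a atTop (𝓝 0) →
    Dense {x : X | {n : ℕ+ | ¬ a n ≤ ‖(T ^ (n : ℕ)) x - Tinf x‖}.Finite}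

/-- Arbitrarily slow convergence of `T ^ n` to `Tinf`, variant 3: there are `x` in `X` and a
functional `y` on `X` with `Re ⟨T ^ n x - Tinf x, y⟩ ≥ a n` for all `n`; moreover, whenever `X` is
isometrically embedded (by `ι`) in the dual of a Banach space `Y`, one can choose `y` in `Y`. -/
def ASC3 (T Tinf : X →L[ℂ] X) : Prop :=
  ∀ a : ℕ+ → ℝ, (∀ n, 0 < a n) → Tendsto a atTop (𝓝 0) →
    ∃ x : X,
      (∃ y : StrongDual ℂ X, ∀ n : ℕ+, a n ≤ (y ((T ^ (n : ℕ)) x - Tinf x)).re) ∧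
      ∀ (Y : Type v) [NormedAddCommGroup Y] [NormedSpace ℂ Y] [CompleteSpace Y]
        (ι : X →ₗᵢ[ℂ] StrongDual ℂ Y),
        ∃ y : Y, ∀ n : ℕ+, a n ≤ (ι ((T ^ (n : ℕ)) x - Tinf x) y).re

end Banach

section Hilbert

variable {H : Type u} [NormedAddCommGroup H] [InnerProductSpace ℂ H]

/-- Arbitrarily slow convergence of `T ^ n` to `Tinf`, Hilbertian version. -/
def ASCH (T Tinf : H →L[ℂ] H) : Prop :=
  ∀ ε : ℝ, 0 < ε → ∀ a : ℕ+ → ℝ, (∀ n, 0 < a n) → Tendsto a atTop (𝓝 0) →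
    ∃ x : H, ‖x‖ < √(⨆ n, a n) + ε ∧
      ∀ n : ℕ+, a n ≤ (inner ℂ x ((T ^ (n : ℕ)) x - Tinf x)).re

/-- The Hilbertian version of arbitrarily slow convergence, for random products of the orthogonal
projections onto `M_1, …, M_N`. -/
def ASCHRandom [CompleteSpace H] {N : ℕ} (M : Fin N → ClosedSubmodule ℂ H) : Prop :=
  ∀ ε : ℝ, 0 < ε → ∀ a : ℕ → ℝ, (∀ n, 0 < a n) → Tendsto a atTop (𝓝 0) →
    ∀ i : ℕ → Fin N, ∃ x : H, ‖x‖ < √(⨆ n, a n) + ε ∧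
      ∀ n : ℕ, 1 ≤ n → a n < (inner ℂ x (randomProduct M i n x - proj (⨅ j, M j) x)).re

end Hilbert

end AltProj

set_option linter.unusedSectionVars false

namespace AltProj

/-! ### Products of projections and weakly null families -/

section Words

variable {H : Type u} [NormedAddCommGroup H] [InnerProductSpace ℂ H] [CompleteSpace H]

/-! Case c < 1. If T lowers ‖x‖² by only D, then by Pythagoras each factor moves its input by at
most √D, so x is within N√D of every M_j (`norm_sub_proj_le_of_mem`). For x ⊥ M the Friedrichs
number bounds the sum of the squared distances to the M_j below by (N-1)(1-c)‖x‖²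
(`sum_norm_sub_proj_sq_ge`). Hence D is at least a fixed fraction of ‖x‖², and T - P_M, whose powers
are T^n - P_M, is a strict contraction.

Case c = 1. There are unit vectors w ⊥ M almost fixed by all P_j (`exists_approxFixed`). Along the
filter they generate they are weakly null and asymptotically fixed by every finite product. A slow
vector is the limit of x_{l+1} = x_l + s_l w_l: if w_l is far enough along the filter, this step
adds about s_l² both to ‖x_l‖² and to Re⟨R_k x_l, x_l⟩ for all k up to a prescribed time n_l. The
steps not yet visible at time k thus supply the lower bound, provided that the part already built is
not harmful, that is, liminf Re⟨R_n u, u⟩ ≥ 0 for the partial sums u.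

This proviso rests on the weak convergence of random products
(`exists_tendsto_inner_randomProduct`), with limit Q R_m u, where Q projects onto the intersection
of the subspaces used infinitely often. A dichotomy on the sign of Re⟨Q w, R_m w⟩ yields a class of
admissible partial sums (`exists_slow_randomProduct`).

The other forms of slowness follow: periodic indices give ASCH, which gives ASC1 and ASC3; ASC1 and
strong convergence of T^n give ASC2. -/

theorem proj_mem (S : ClosedSubmodule ℂ H) (x : H) : proj S x ∈ S :=
  Submodule.starProjection_apply_mem S.toSubmodule x

theorem proj_eq_self {S : ClosedSubmodule ℂ H} {x : H} (hx : x ∈ S) : proj S x = x :=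
  Submodule.starProjection_eq_self_iff.2 hx

theorem sub_proj_mem (S : ClosedSubmodule ℂ H) (x : H) : x - proj S x ∈ S.toSubmoduleᗮ :=
  Submodule.sub_starProjection_mem_orthogonal x

theorem proj_eq_zero {S : ClosedSubmodule ℂ H} {x : H} (hx : x ∈ S.toSubmoduleᗮ) :
    proj S x = 0 :=
  (Submodule.starProjection_apply_eq_zero_iff _).2 hx

theorem inner_proj (S : ClosedSubmodule ℂ H) (x y : H) :
    inner ℂ (proj S x) y = inner ℂ x (proj S y) :=
  Submodule.inner_starProjection_left_eq_right S.toSubmodule x y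

theorem norm_proj_le (S : ClosedSubmodule ℂ H) (x : H) : ‖proj S x‖ ≤ ‖x‖ :=
  Submodule.norm_starProjection_apply_le S.toSubmodule x

theorem norm_sq_eq_proj (S : ClosedSubmodule ℂ H) (x : H) :
    ‖x‖ ^ 2 = ‖proj S x‖ ^ 2 + ‖x - proj S x‖ ^ 2 := by
  have h := Submodule.norm_sq_eq_add_norm_sq_starProjection x S.toSubmodule
  rw [Submodule.starProjection_orthogonal_val] at h
  exact h

theorem norm_sub_proj_le (S : ClosedSubmodule ℂ H) (x : H) {z : H} (hz : z ∈ S) :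
    ‖x - proj S x‖ ≤ ‖x - z‖ := by
  have h := norm_sq_eq_proj S (x - z)
  rw [map_sub, proj_eq_self hz, sub_sub_sub_cancel_right] at h
  exact le_of_sq_le_sq (by nlinarith [sq_nonneg ‖proj S x - z‖]) (norm_nonneg _)

variable {N : ℕ} (M : Fin N → ClosedSubmodule ℂ H)

/-- The product of the projections whose indices are listed in `l`; the last one acts first. -/
noncomputable def word (l : List (Fin N)) : H →L[ℂ] H :=
  (l.map fun j => proj (M j)).prod

@[simp] theorem word_nil : word M [] = 1 := rfl

theorem word_cons (j : Fin N) (l : List (Fin N)) (x : H) :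
    word M (j :: l) x = proj (M j) (word M l x) := by
  simp [word]

theorem word_append (l l' : List (Fin N)) (x : H) :
    word M (l ++ l') x = word M l (word M l' x) := by
  simp [word]

theorem norm_word_le (l : List (Fin N)) (x : H) : ‖word M l x‖ ≤ ‖x‖ := by
  induction l with
  | nil => simp
  | cons j l ih =>
    rw [word_cons]
    exact (norm_proj_le _ _).trans ih

theorem inner_word (l : List (Fin N)) (x y : H) :
    inner ℂ (word M l x) y = inner ℂ x (word M l.reverse y) := by
  induction l generalizing y with
  | nil => simp
  | cons j l ih =>
    rw [word_cons, inner_proj, ih, List.reverse_cons, word_append, word_cons]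
    simp

theorem word_eq_self {l : List (Fin N)} {x : H} (hx : ∀ j ∈ l, x ∈ M j) : word M l x = x := by
  induction l with
  | nil => simp
  | cons j l ih =>
    rw [word_cons, ih fun k hk => hx k (List.mem_cons_of_mem _ hk),
      proj_eq_self (hx j (List.mem_cons_self ..))]

theorem inner_word_of_mem {l : List (Fin N)} {v : H} (hv : ∀ j ∈ l, v ∈ M j) (x : H) :
    inner ℂ (word M l x) v = inner ℂ x v := by
  rw [inner_word, word_eq_self]
  simpa using hv

/-- By Pythagoras each factor moves its input by the square root of the drop in squared norm it
causes, which is at most the total drop; the triangle inequality adds the moves. -/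
theorem norm_sub_word_le (l : List (Fin N)) {x : H} {d : ℝ} (hd : 0 ≤ d)
    (h : ‖x‖ ^ 2 - ‖word M l x‖ ^ 2 ≤ d ^ 2) : ‖x - word M l x‖ ≤ l.length * d := by
  induction l with
  | nil => simp
  | cons j l ih =>
    rw [word_cons] at h ⊢
    have h1 := norm_sq_eq_proj (M j) (word M l x)
    have h2 := norm_word_le M l x
    have h3 : ‖word M l x‖ ^ 2 ≤ ‖x‖ ^ 2 := by gcongr
    have h4 := ih (by nlinarith [sq_nonneg ‖word M l x - proj (M j) (word M l x)‖])
    have h5 : ‖word M l x - proj (M j) (word M l x)‖ ≤ d :=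
      le_of_sq_le_sq (by linarith) hd
    have h6 := norm_sub_le_norm_sub_add_norm_sub x (word M l x) (proj (M j) (word M l x))
    push_cast [List.length_cons]
    linarith

theorem tendsto_word_sub {α : Type*} {F : Filter α} {w : α → H}
    (h : ∀ j, Tendsto (fun a => proj (M j) (w a) - w a) F (𝓝 0)) (l : List (Fin N)) :
    Tendsto (fun a => word M l (w a) - w a) F (𝓝 0) := by
  induction l with
  | nil => simpa using tendsto_const_nhds
  | cons j l ih =>
    have h1 := (((proj (M j)).continuous.tendsto 0).comp ih).add (h j)
    simpa [word_cons, Function.comp_def] using h1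

theorem cyclicProduct_eq_word : cyclicProduct M = word M (List.finRange N).reverse := by
  simp [cyclicProduct, word, List.ofFn_eq_map]

theorem randomProduct_eq_word (i : ℕ → Fin N) (m n : ℕ) : ∃ l : List (Fin N),
    (∀ j ∈ l, ∃ k, m ≤ k ∧ i k = j) ∧ ∀ x,
      randomProduct M i (m + n) x = word M l (randomProduct M i m x) := by
  induction n with
  | zero => exact ⟨[], by simp, by simp⟩
  | succ n ih =>
    obtain ⟨l, hl, h⟩ := ih
    refine ⟨i (m + n) :: l, ?_, fun x => ?_⟩
    · intro j hj
      rcases List.mem_cons.1 hj with rfl | hj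
      · exact ⟨m + n, by simp, rfl⟩
      · exact hl j hj
    · rw [word_cons, ← h]
      rfl

/-- The intersection of the subspaces with indices in `A`. -/
noncomputable def inter (A : Finset (Fin N)) : ClosedSubmodule ℂ H := ⨅ j : A, M j

theorem mem_inter {A : Finset (Fin N)} {x : H} : x ∈ inter M A ↔ ∀ j ∈ A, x ∈ M j := by
  simp [inter]

theorem inter_univ : inter M Finset.univ = ⨅ j, M j := by
  ext x
  simp [mem_inter]

/-- A vector orthogonal to `V` is orthogonal to each `(M j)ᗮ`, so it lies in each `M j`, hence in
`V` itself. Applied to `weakNull`, this reduces weak limits to two kinds of test vectors. -/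
theorem submodule_eq_top {A : Finset (Fin N)} {V : Submodule ℂ H} (hV : IsClosed (V : Set H))
    (h1 : ∀ x ∈ inter M A, x ∈ V) (h2 : ∀ j ∈ A, ∀ x ∈ (M j).toSubmoduleᗮ, x ∈ V) : V = ⊤ := by
  have : CompleteSpace V := hV.completeSpace_coe
  rw [← Submodule.orthogonal_eq_bot_iff, eq_bot_iff]
  intro x hx
  have h3 : x ∈ V := by
    refine h1 x ((mem_inter M).2 fun j hj => ?_)
    have h4 : x ∈ ((M j).toSubmoduleᗮ)ᗮ := Submodule.orthogonal_le (h2 j hj) hx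
    rwa [Submodule.orthogonal_orthogonal] at h4
  exact inner_self_eq_zero.1 ((Submodule.mem_orthogonal _ _).1 hx x h3)

/-- The vectors whose inner products with a bounded family tend to zero. -/
def weakNull {α : Type*} (F : Filter α) (g : α → H) : Submodule ℂ H where
  carrier := {v | Tendsto (fun a => inner ℂ (g a) v) F (𝓝 0)}
  add_mem' := by
    intro v w hv hw
    simpa [inner_add_right] using Tendsto.add hv hw
  zero_mem' := by simpa using tendsto_const_nhds
  smul_mem' := by
    intro c v hv
    simpa [inner_smul_right] using Tendsto.const_mul c hv

theorem mem_weakNull {α : Type*} {F : Filter α} {g : α → H} {v : H} :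
    v ∈ weakNull F g ↔ Tendsto (fun a => inner ℂ (g a) v) F (𝓝 0) := Iff.rfl

theorem isClosed_weakNull {α : Type*} {F : Filter α} {g : α → H} {C : ℝ}
    (hg : ∀ᶠ a in F, ‖g a‖ ≤ C) : IsClosed (weakNull F g : Set H) := by
  rw [← isSeqClosed_iff_isClosed]
  intro v x hv hx
  rw [SetLike.mem_coe, mem_weakNull, Metric.tendsto_nhds]
  intro ε hε
  have hC : 0 < |C| + 1 := by positivity
  obtain ⟨n, hn⟩ := ((Metric.tendsto_nhds.1 hx) (ε / 2 / (|C| + 1)) (by positivity)).exists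
  have h1 := (Metric.tendsto_nhds.1 (hv n)) (ε / 2) (by positivity)
  filter_upwards [h1, hg] with a ha hga
  rw [dist_zero_right] at ha ⊢
  rw [dist_eq_norm] at hn
  have h2 : (inner ℂ (g a) x : ℂ) = inner ℂ (g a) (v n) - inner ℂ (g a) (v n - x) := by
    rw [inner_sub_right]; ring
  have h3 := norm_inner_le_norm (𝕜 := ℂ) (g a) (v n - x)
  have h4 : ‖g a‖ * ‖v n - x‖ ≤ (|C| + 1) * (ε / 2 / (|C| + 1)) := by
    gcongr
    linarith [le_abs_self C]
  rw [mul_div_cancel₀ _ hC.ne'] at h4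
  rw [h2]
  linarith [norm_sub_le (inner ℂ (g a) (v n) : ℂ) (inner ℂ (g a) (v n - x))]

end Words

/-! ### Weak convergence of random products -/

section WeakConvergence

variable {H : Type u} [NormedAddCommGroup H] [InnerProductSpace ℂ H] [CompleteSpace H]
variable {N : ℕ} (M : Fin N → ClosedSubmodule ℂ H)

theorem inner_eq_zero_of_mem {S : ClosedSubmodule ℂ H} {x v : H} (hx : x ∈ S)
    (hv : v ∈ S.toSubmoduleᗮ) : inner ℂ x v = 0 :=
  (Submodule.mem_orthogonal _ _).1 hv x hx

/-- Cut `l` at its first and at its last occurrence of `j`. The vectors just after these two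
applications of `proj (M j)` are orthogonal to `v`, and the last occurrence in the list, which acts
earliest, moves its input by at most the square root of the total norm drop. The two remaining words
avoid `j`, which permits induction on the alphabet. -/
theorem exists_split_norm_inner_word_sub_le (j : Fin N) (l : List (Fin N)) :
    ∃ l1 l2 l3 l4 : List (Fin N), l = l1 ++ l2 ∧ l = l3 ++ l4 ∧ j ∉ l1 ∧ j ∉ l4 ∧
      ∀ v ∈ (M j).toSubmoduleᗮ, ∀ y, ‖inner ℂ (word M l y - y) v‖ ≤
        ‖inner ℂ (word M l1 (word M l2 y) - word M l2 y) v‖ + ‖inner ℂ (word M l4 y - y) v‖ +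
          √(‖y‖ ^ 2 - ‖word M l y‖ ^ 2) * ‖v‖ := by
  by_cases hj : j ∈ l
  · obtain ⟨a, b, hab, hja⟩ := List.eq_append_cons_of_mem hj
    obtain ⟨c, d, hcd, hjc⟩ := List.eq_append_cons_of_mem (List.mem_reverse.2 hj)
    have hl : l = (d.reverse ++ [j]) ++ c.reverse := by
      rw [← List.reverse_reverse l, hcd]
      simp
    refine ⟨a, j :: b, d.reverse ++ [j], c.reverse, hab, hl, hja, by simpa using hjc,
      fun v hv y => ?_⟩
    have h1 : inner ℂ (word M (j :: b) y) v = 0 := by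
      rw [word_cons]
      exact inner_eq_zero_of_mem (proj_mem _ _) hv
    set z := word M c.reverse y with hz
    have h2 : inner ℂ (proj (M j) z) v = 0 := inner_eq_zero_of_mem (proj_mem _ _) hv
    have h3 : word M l y = word M d.reverse (proj (M j) z) := by
      rw [hl, word_append, word_append, word_cons]
      simp [hz]
    have h4 : ‖z - proj (M j) z‖ ≤ √(‖y‖ ^ 2 - ‖word M l y‖ ^ 2) := by
      apply Real.le_sqrt_of_sq_le
      have h5 := norm_sq_eq_proj (M j) z
      have h6 : ‖z‖ ^ 2 ≤ ‖y‖ ^ 2 := by gcongr; exact norm_word_le _ _ _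
      have h7 : ‖word M l y‖ ^ 2 ≤ ‖proj (M j) z‖ ^ 2 := by
        rw [h3]; gcongr; exact norm_word_le _ _ _
      linarith
    have h8 : inner ℂ (word M l y - y) v =
        inner ℂ (word M a (word M (j :: b) y) - word M (j :: b) y) v +
          inner ℂ (z - y) v - inner ℂ (z - proj (M j) z) v := by
      rw [← word_append, ← hab]
      simp only [inner_sub_left, h1, h2]
      ring
    have h9 : ‖inner ℂ (z - proj (M j) z) v‖ ≤ √(‖y‖ ^ 2 - ‖word M l y‖ ^ 2) * ‖v‖ :=
      (norm_inner_le_norm _ _).trans (by gcongr)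
    rw [h8]
    exact (norm_sub_le _ _).trans (add_le_add (norm_add_le _ _) h9)
  · refine ⟨[], l, [], l, rfl, rfl, by simp, hj, fun v _ y => ?_⟩
    have : 0 ≤ √(‖y‖ ^ 2 - ‖word M l y‖ ^ 2) * ‖v‖ := by positivity
    simp only [word_nil, one_apply_eq_self, sub_self, inner_zero_left, norm_zero,
      zero_add]
    linarith

/-- If words in the letters of `A` decrease the norm of bounded vectors by less and less, then they
move these vectors less and less in the weak sense. -/
theorem tendsto_inner_word_sub {α : Type*} (A : Finset (Fin N)) {F : Filter α}
    {l : α → List (Fin N)} {y : α → H} {C : ℝ} (hl : ∀ a, ∀ j ∈ l a, j ∈ A)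
    (hy : ∀ a, ‖y a‖ ≤ C)
    (h : Tendsto (fun a => ‖y a‖ ^ 2 - ‖word M (l a) (y a)‖ ^ 2) F (𝓝 0)) (v : H) :
    Tendsto (fun a => inner ℂ (word M (l a) (y a) - y a) v) F (𝓝 0) := by
  -- The words `l1` and `l4` of the splitting use only `A.erase j`, and their norm drops are bounded
  -- by that of the whole word.
  induction A using Finset.strongInduction generalizing l y v with
  | H A ih =>
    suffices hV : weakNull F (fun a => word M (l a) (y a) - y a) = ⊤ by
      rw [← mem_weakNull, hV]
      trivial
    refine submodule_eq_top M (A := A) (isClosed_weakNull (C := C + C) ?_) ?_ ?_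
    · filter_upwards with a
      exact (norm_sub_le _ _).trans (add_le_add ((norm_word_le _ _ _).trans (hy a)) (hy a))
    · intro x hx
      rw [mem_inter] at hx
      rw [mem_weakNull]
      simp only [inner_sub_left, inner_word_of_mem M fun j hj => hx j (hl _ j hj), sub_self]
      exact tendsto_const_nhds
    · intro j hj v hv
      choose l1 l2 l3 l4 h12 h34 hj1 hj4 hle using
        fun a => exists_split_norm_inner_word_sub_le M j (l a)
      have hmem : ∀ {l' : List (Fin N)} {a : α}, j ∉ l' → l' ⊆ l a → ∀ k ∈ l', k ∈ A.erase j :=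
        fun h1 h2 k hk => Finset.mem_erase.2 ⟨by rintro rfl; exact h1 hk, hl _ k (h2 hk)⟩
      have hword : ∀ a, word M (l a) (y a) = word M (l1 a) (word M (l2 a) (y a)) := by
        intro a
        rw [← word_append, ← h12]
      have hword' : ∀ a, word M (l a) (y a) = word M (l3 a) (word M (l4 a) (y a)) := by
        intro a
        rw [← word_append, ← h34]
      have t1 := ih (A.erase j) (Finset.erase_ssubset hj) (l := l1)
        (y := fun a => word M (l2 a) (y a))
        (fun a => hmem (hj1 a) (by rw [h12 a]; exact List.subset_append_left _ _))
        (fun a => (norm_word_le _ _ _).trans (hy a)) (by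
          refine squeeze_zero (fun a => ?_) (fun a => ?_) h
          · rw [sub_nonneg]; gcongr; exact norm_word_le _ _ _
          · rw [hword]; gcongr; exact norm_word_le _ _ _) v
      have t2 := ih (A.erase j) (Finset.erase_ssubset hj) (l := l4) (y := y)
        (fun a => hmem (hj4 a) (by rw [h34 a]; exact List.subset_append_right _ _)) hy (by
          refine squeeze_zero (fun a => ?_) (fun a => ?_) h
          · rw [sub_nonneg]; gcongr; exact norm_word_le _ _ _
          · rw [hword']; gcongr; exact norm_word_le _ _ _) v
      have t3 := ((Real.continuous_sqrt.tendsto 0).comp h).mul_const ‖v‖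
      rw [mem_weakNull]
      refine squeeze_zero_norm (fun a => hle a v hv (y a)) ?_
      simpa [Function.comp_def] using (t1.norm.add t2.norm).add t3

theorem norm_randomProduct_le (i : ℕ → Fin N) (n : ℕ) (x : H) :
    ‖randomProduct M i n x‖ ≤ ‖x‖ := by
  obtain ⟨l, -, hl⟩ := randomProduct_eq_word M i 0 n
  rw [zero_add] at hl
  rw [hl]
  exact norm_word_le M l _

theorem antitone_norm_randomProduct (i : ℕ → Fin N) (x : H) :
    Antitone fun n => ‖randomProduct M i n x‖ ^ 2 := by
  refine antitone_nat_of_succ_le fun n => ?_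
  gcongr
  exact norm_proj_le _ _

/-- From any time `n` the orbit enters `M j` later, where it is orthogonal to `v`. The norms along
the orbit converge, so the drop on this stretch tends to zero, and so does the weak displacement. -/
theorem tendsto_inner_randomProduct_zero {i : ℕ → Fin N} {j : Fin N}
    (hj : ∃ᶠ n in atTop, i n = j) (x : H) {v : H} (hv : v ∈ (M j).toSubmoduleᗮ) :
    Tendsto (fun n => inner ℂ (randomProduct M i n x) v) atTop (𝓝 0) := by
  have hex : ∀ n, ∃ k, i (n + k) = j := by
    intro n
    obtain ⟨k, hk, h⟩ := frequently_atTop.1 hj n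
    exact ⟨k - n, by rwa [Nat.add_sub_cancel' hk]⟩
  choose k hk using hex
  choose l hl hword using fun n => randomProduct_eq_word M i n (k n + 1)
  have hconv : ∃ L, Tendsto (fun n => ‖randomProduct M i n x‖ ^ 2) atTop (𝓝 L) :=
    ⟨_, tendsto_atTop_ciInf (antitone_norm_randomProduct M i x)
      ⟨0, by rintro _ ⟨n, rfl⟩; positivity⟩⟩
  obtain ⟨L, hL⟩ := hconv
  have h1 : Tendsto (fun n => n + (k n + 1)) atTop atTop :=
    tendsto_atTop_mono (fun n => Nat.le_add_right n _) tendsto_id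
  have h2 := tendsto_inner_word_sub M Finset.univ (F := atTop) (l := l)
    (y := fun n => randomProduct M i n x) (C := ‖x‖) (by simp)
    (fun n => norm_randomProduct_le M i n x) (by
      have := hL.sub (hL.comp h1)
      simpa [Function.comp_def, hword] using this) v
  have h3 := h2.neg
  simp only [← hword] at h3
  have h4 : ∀ n, inner ℂ (randomProduct M i (n + (k n + 1)) x) v = 0 := by
    intro n
    refine inner_eq_zero_of_mem (S := M j) ?_ hv
    have : randomProduct M i (n + (k n + 1)) x =
      proj (M (i (n + k n))) (randomProduct M i (n + k n) x) := rfl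
    rw [this, hk]
    exact proj_mem _ _
  simpa [inner_sub_left, h4] using h3

/-- Random products converge weakly: after the indices that occur only finitely often have been
used up, the limit is the projection onto the intersection of the remaining subspaces. -/
theorem exists_tendsto_inner_randomProduct (i : ℕ → Fin N) : ∃ (A : Finset (Fin N)) (m : ℕ),
    ∀ x v, Tendsto (fun n => inner ℂ (randomProduct M i n x) v) atTop
      (𝓝 (inner ℂ (proj (inter M A) (randomProduct M i m x)) v)) := by
  classical
  -- `A` collects the indices used infinitely often; from time `m` on no others occur, so inner
  -- products with vectors of `inter M A` are frozen.
  set A : Finset (Fin N) := Finset.univ.filter fun j => ∃ᶠ n in atTop, i n = j with hA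
  have h1 : ∀ᶠ n in atTop, ∀ j, j ∉ A → i n ≠ j := by
    rw [eventually_all]
    intro j
    by_cases hj : j ∈ A
    · simp [hj]
    · have : ∀ᶠ n in atTop, i n ≠ j := by simpa [hA, Filter.not_frequently] using hj
      filter_upwards [this] with n hn _ using hn
  obtain ⟨m, hm⟩ := eventually_atTop.1 h1
  refine ⟨A, m, fun x v => ?_⟩
  set q := proj (inter M A) (randomProduct M i m x) with hq
  suffices hV : weakNull atTop (fun n => randomProduct M i n x - q) = ⊤ by
    have : v ∈ weakNull atTop (fun n => randomProduct M i n x - q) := by rw [hV]; trivial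
    rw [mem_weakNull] at this
    simpa [inner_sub_left] using this.add_const (inner ℂ q v)
  refine submodule_eq_top M (A := A) (isClosed_weakNull (C := ‖x‖ + ‖q‖) ?_) ?_ ?_
  · filter_upwards with n
    exact (norm_sub_le _ _).trans (by gcongr; exact norm_randomProduct_le M i n x)
  · intro w hw
    rw [mem_weakNull]
    refine tendsto_const_nhds.congr' ?_
    filter_upwards [eventually_ge_atTop m] with n hn
    obtain ⟨l, hl, h⟩ := randomProduct_eq_word M i m (n - m)
    rw [Nat.add_sub_cancel' hn] at h
    rw [h, inner_sub_left, inner_word_of_mem, hq, inner_proj, proj_eq_self hw, sub_self]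
    intro j hj
    obtain ⟨k, hk, rfl⟩ := hl j hj
    refine (mem_inter M).1 hw _ ?_
    by_contra hc
    exact hm k hk _ hc rfl
  · intro j hj w hw
    have h2 := tendsto_inner_randomProduct_zero M (by simpa [hA] using hj : ∃ᶠ n in atTop, i n = j)
      x hw
    have h3 : inner ℂ q w = 0 :=
      inner_eq_zero_of_mem ((mem_inter M).1 (proj_mem _ _) j hj) hw
    rw [mem_weakNull]
    simpa [inner_sub_left, h3] using h2

end WeakConvergence

/-! ### Construction of slow vectors from approximately fixed ones -/

section SlowVectors

variable {H : Type u} [NormedAddCommGroup H] [InnerProductSpace ℂ H]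

/-- A filter of asymptotically normalized weakly null vectors which are asymptotically fixed by all
operators `R n`. -/
structure IsApproxFixed (R : ℕ → H →L[ℂ] H) (F : Filter H) : Prop where
  tendsto_norm : Tendsto (fun w => ‖w‖) F (𝓝 1)
  tendsto_inner : ∀ v, Tendsto (fun w => inner ℂ w v) F (𝓝 0)
  tendsto_sub : ∀ n, Tendsto (fun w => R n w - w) F (𝓝 0)

variable {R : ℕ → H →L[ℂ] H} {F : Filter H}

theorem IsApproxFixed.tendsto_re_inner (h : IsApproxFixed R F) (v : H) :
    Tendsto (fun w => (inner ℂ v w).re) F (𝓝 0) := by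
  have h1 := (Complex.continuous_re.tendsto 0).comp (h.tendsto_inner v)
  have h2 : ∀ w, (inner ℂ v w).re = (inner ℂ w v).re := fun w => inner_re_symm (𝕜 := ℂ) v w
  simpa [Function.comp_def, h2] using h1

theorem IsApproxFixed.tendsto_norm_sq (h : IsApproxFixed R F) (u : H) (s : ℝ) :
    Tendsto (fun w => ‖u + (s : ℂ) • w‖ ^ 2) F (𝓝 (‖u‖ ^ 2 + s ^ 2)) := by
  have h1 : ∀ w : H, ‖u + (s : ℂ) • w‖ ^ 2 =
      ‖u‖ ^ 2 + 2 * (s * (inner ℂ u w).re) + s ^ 2 * ‖w‖ ^ 2 := by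
    intro w
    rw [norm_add_sq (𝕜 := ℂ), inner_smul_right, norm_smul, mul_pow]
    simp
  simp only [h1]
  have h2 := ((((h.tendsto_re_inner u).const_mul s).const_mul 2).const_add (‖u‖ ^ 2)).add
    ((h.tendsto_norm.pow 2).const_mul (s ^ 2))
  simpa using h2

theorem IsApproxFixed.tendsto_inner_apply_self (h : IsApproxFixed R F) (n : ℕ) :
    Tendsto (fun w => inner ℂ w (R n w)) F (𝓝 1) := by
  have hb : ∀ᶠ w in F, ‖w‖ ≤ 2 := h.tendsto_norm.eventually_le_const (by norm_num)
  have h1 : Tendsto (fun w => inner ℂ w (R n w - w)) F (𝓝 0) := by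
    refine squeeze_zero_norm' ?_ (by simpa using (h.tendsto_sub n).norm.const_mul 2)
    filter_upwards [hb] with w hw
    exact (norm_inner_le_norm _ _).trans (by gcongr)
  have h2 : Tendsto (fun w : H => ((‖w‖ ^ 2 : ℝ) : ℂ)) F (𝓝 1) := by
    have := (Complex.continuous_ofReal.tendsto 1).comp (by simpa using h.tendsto_norm.pow 2)
    simpa [Function.comp_def] using this
  have h3 := h1.add h2
  simp only [inner_sub_right, inner_self_eq_norm_sq_to_K] at h3
  simpa using h3

theorem IsApproxFixed.tendsto_re_inner_apply (h : IsApproxFixed R F) (n : ℕ) (u : H) (s : ℝ) :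
    Tendsto (fun w => (inner ℂ (u + (s : ℂ) • w) (R n (u + (s : ℂ) • w))).re) F
      (𝓝 ((inner ℂ u (R n u)).re + s ^ 2)) := by
  have h1 : Tendsto (fun w => (inner ℂ u (R n w - w)).re) F (𝓝 0) := by
    have : Continuous fun z : H => (inner ℂ u z).re := by fun_prop
    have := (this.tendsto 0).comp (h.tendsto_sub n)
    simpa [Function.comp_def] using this
  have h2 := h1.add (h.tendsto_re_inner u)
  have h3 := (Complex.continuous_re.tendsto _).comp (h.tendsto_inner (R n u))
  have h4 := (Complex.continuous_re.tendsto _).comp (h.tendsto_inner_apply_self n)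
  have h5 := (((h2.const_mul s).add (h3.const_mul s)).add (h4.const_mul (s ^ 2))).const_add
    (inner ℂ u (R n u)).re
  simp only [Function.comp_def, Complex.zero_re, Complex.one_re, mul_zero, add_zero, zero_add,
    mul_one] at h5
  refine h5.congr fun w => ?_
  simp only [map_add, map_smul, inner_add_left, inner_add_right, inner_smul_left,
    inner_smul_right, inner_sub_right, Complex.conj_ofReal, Complex.add_re, Complex.re_ofReal_mul,
    Complex.sub_re]
  ring

variable [F.NeBot] {U : Set H}

/-- Weak nullness kills all cross terms in the limit, so adding `s • w` adds `s ^ 2` to each squared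
distance and each quadratic form, up to the tolerance `ρ`. Finitely many such demands hold
eventually, hence together with the frequent condition `hb`. -/
theorem IsApproxFixed.exists_step (h : IsApproxFixed R F)
    (hb : ∀ u ∈ U, ∀ s : ℝ, 0 < s → ∃ᶠ w in F, u + (s : ℂ) • w ∈ U)
    {u : H} (hu : u ∈ U) {s ρ : ℝ} (hs : 0 < s) (hρ : 0 < ρ) (G : Finset H) (n : ℕ) :
    ∃ z ∈ U, (∀ v ∈ G, ‖z - v‖ ^ 2 ≤ ‖u - v‖ ^ 2 + (1 + ρ) * s ^ 2) ∧
      ∀ k ≤ n, (inner ℂ u (R k u)).re + (1 - ρ) * s ^ 2 ≤ (inner ℂ z (R k z)).re := by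
  have hpos : 0 < ρ * s ^ 2 := by positivity
  have h1 : ∀ᶠ w in F, ∀ v ∈ G,
      ‖u + (s : ℂ) • w - v‖ ^ 2 ≤ ‖u - v‖ ^ 2 + (1 + ρ) * s ^ 2 := by
    rw [eventually_all_finset]
    intro v _
    filter_upwards [(h.tendsto_norm_sq (u - v) s).eventually_le_const
      (show ‖u - v‖ ^ 2 + s ^ 2 < ‖u - v‖ ^ 2 + (1 + ρ) * s ^ 2 by linarith)] with w hw
    rwa [add_sub_right_comm]
  have h2 : ∀ᶠ w in F, ∀ k ∈ Finset.range (n + 1), (inner ℂ u (R k u)).re + (1 - ρ) * s ^ 2 ≤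
      (inner ℂ (u + (s : ℂ) • w) (R k (u + (s : ℂ) • w))).re := by
    rw [eventually_all_finset]
    intro k _
    exact (h.tendsto_re_inner_apply k u s).eventually_const_le (by linarith)
  obtain ⟨w, hw, hw1, hw2⟩ := ((hb u hu s hs).and_eventually (h1.and h2)).exists
  exact ⟨_, hw, hw1, fun k hk => hw2 k (Finset.mem_range.2 (by omega))⟩

/-- Weights are fixed in advance. After each new vector a time is chosen past which its quadratic
form is almost nonnegative and `a` has become small; the next step then respects all earlier times.
-/
theorem IsApproxFixed.exists_seq (h : IsApproxFixed R F) (h0 : (0 : H) ∈ U)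
    (ha : ∀ u ∈ U, ∀ ε : ℝ, 0 < ε → ∀ᶠ n in atTop, -ε ≤ (inner ℂ u (R n u)).re)
    (hb : ∀ u ∈ U, ∀ s : ℝ, 0 < s → ∃ᶠ w in F, u + (s : ℂ) • w ∈ U)
    {s β γ : ℕ → ℝ} (hs : ∀ l, 0 < s l) (hβ : ∀ l, 0 < β l) (hγ : ∀ l, 0 < γ l) {ρ : ℝ}
    (hρ : 0 < ρ) {a : ℕ → ℝ} (hlim : Tendsto a atTop (𝓝 0)) :
    ∃ (x : ℕ → H) (n : ℕ → ℕ), x 0 = 0 ∧ n 0 = 0 ∧ StrictMono n ∧ (∀ l, x l ∈ U) ∧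
      (∀ l, ∀ j ≤ l, ‖x (l + 1) - x j‖ ^ 2 ≤ ‖x l - x j‖ ^ 2 + (1 + ρ) * s l ^ 2) ∧
      (∀ l, ∀ k ≤ n l, (inner ℂ (x l) (R k (x l))).re + (1 - ρ) * s l ^ 2 ≤
        (inner ℂ (x (l + 1)) (R k (x (l + 1)))).re) ∧
      ∀ l, ∀ k ≥ n (l + 1), -β (l + 1) ≤ (inner ℂ (x (l + 1)) (R k (x (l + 1)))).re ∧
        a k < γ (l + 1) := by
  classical
  -- The state consists of the current vector, the finite set of all vectors so far (for the
  -- distance bounds) and the current time.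
  have step : ∀ (l : ℕ) (p : {p : H × Finset H × ℕ // p.1 ∈ U}),
      ∃ q : {p : H × Finset H × ℕ // p.1 ∈ U}, q.1.2.1 = insert q.1.1 p.1.2.1 ∧
        p.1.2.2 < q.1.2.2 ∧
        (∀ v ∈ p.1.2.1, ‖q.1.1 - v‖ ^ 2 ≤ ‖p.1.1 - v‖ ^ 2 + (1 + ρ) * s l ^ 2) ∧
        (∀ k ≤ p.1.2.2, (inner ℂ p.1.1 (R k p.1.1)).re + (1 - ρ) * s l ^ 2 ≤
          (inner ℂ q.1.1 (R k q.1.1)).re) ∧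
        ∀ k ≥ q.1.2.2, -β (l + 1) ≤ (inner ℂ q.1.1 (R k q.1.1)).re ∧ a k < γ (l + 1) := by
    rintro l ⟨⟨u, G, n⟩, hu⟩
    obtain ⟨z, hz, hz1, hz2⟩ := h.exists_step hb hu (hs l) hρ G n
    obtain ⟨m, hm⟩ := eventually_atTop.1 ((ha z hz _ (hβ (l + 1))).and
      (hlim.eventually_lt_const (hγ (l + 1))))
    exact ⟨⟨⟨z, insert z G, max m (n + 1)⟩, hz⟩, rfl, by simp, hz1, hz2,
      fun k hk => hm k (le_trans (le_max_left _ _) hk)⟩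
  choose g hg1 hg2 hg3 hg4 hg5 using step
  let p : ℕ → {p : H × Finset H × ℕ // p.1 ∈ U} := fun l =>
    Nat.rec ⟨⟨0, {0}, 0⟩, h0⟩ (fun l q => g l q) l
  have hp : ∀ l, p (l + 1) = g l (p l) := fun l => rfl
  have hmem : ∀ l, ∀ j ≤ l, (p j).1.1 ∈ (p l).1.2.1 := by
    intro l
    induction l with
    | zero =>
      intro j hj
      obtain rfl : j = 0 := by omega
      exact Finset.mem_singleton_self _
    | succ l ih =>
      intro j hj
      rw [hp, hg1, ← hp]
      rcases hj.lt_or_eq with hj | rfl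
      · exact Finset.mem_insert_of_mem (ih j (by omega))
      · exact Finset.mem_insert_self _ _
  refine ⟨fun l => (p l).1.1, fun l => (p l).1.2.2, rfl, rfl, strictMono_nat_of_lt_succ fun l => ?_,
    fun l => (p l).2, fun l j hj => ?_, fun l => ?_, fun l => ?_⟩
  · rw [hp]; exact hg2 _ _
  · simp only [hp]; exact hg3 _ _ _ (hmem l j hj)
  · simp only [hp]; exact hg4 _ _
  · simp only [hp]; exact hg5 _ _

theorem re_inner_apply_ge {T : H →L[ℂ] H} (hT : ∀ x, ‖T x‖ ≤ ‖x‖) (u z : H) :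
    (inner ℂ u (T u)).re - (2 * (‖z - u‖ * ‖u‖) + ‖z - u‖ ^ 2) ≤ (inner ℂ z (T z)).re := by
  obtain ⟨d, rfl⟩ : ∃ d, z = u + d := ⟨z - u, by abel⟩
  rw [add_sub_cancel_left]
  have key : ∀ x y : H, -(‖x‖ * ‖y‖) ≤ (inner ℂ x (T y)).re := by
    intro x y
    have h1 := Complex.abs_re_le_norm (inner ℂ x (T y))
    have h2 := norm_inner_le_norm (𝕜 := ℂ) x (T y)
    have h3 : ‖x‖ * ‖T y‖ ≤ ‖x‖ * ‖y‖ := by gcongr; exact hT y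
    linarith [neg_abs_le (inner ℂ x (T y)).re]
  simp only [map_add, inner_add_left, inner_add_right, Complex.add_re]
  nlinarith [key u d, key d u, key d d]

/-- With `s l ^ 2 = t l - t (l + 1)` the increments telescope. For `n l ≤ k < n (l + 1)` the vector
`x l` costs at most `ρ * t (l + 1)`, the step to `x (l + 1)` at most as much again, and the later
steps gain `(1 - ρ) * t (l + 1)`, leaving `(1 - 3 * ρ) * t (l + 1)`, which exceeds `a k`. -/
theorem IsApproxFixed.exists_slow_of_weights (h : IsApproxFixed R F) (h0 : (0 : H) ∈ U)
    [CompleteSpace H] (hR : ∀ n x, ‖R n x‖ ≤ ‖x‖)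
    (ha : ∀ u ∈ U, ∀ ε : ℝ, 0 < ε → ∀ᶠ n in atTop, -ε ≤ (inner ℂ u (R n u)).re)
    (hb : ∀ u ∈ U, ∀ s : ℝ, 0 < s → ∃ᶠ w in F, u + (s : ℂ) • w ∈ U)
    {t : ℕ → ℝ} (ht : ∀ l, 0 < t l) (hanti : StrictAnti t) (ht0 : Tendsto t atTop (𝓝 0)) {ρ : ℝ}
    (hρ : 0 < ρ) (hρ3 : 3 * ρ < 1)
    (htρ : ∀ l, (t l - t (l + 1)) * t 0 ≤ (ρ * t (l + 1) / 10) ^ 2)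
    {a : ℕ → ℝ} (hlim : Tendsto a atTop (𝓝 0)) (ha1 : ∀ n, a n < (1 - 3 * ρ) * t 1) :
    ∃ x ∈ closure U, ‖x‖ ^ 2 ≤ (1 + ρ) * t 0 ∧ ∀ n, a n < (inner ℂ x (R n x)).re := by
  have hdiff : ∀ l, 0 < t l - t (l + 1) := fun l => sub_pos.2 (hanti l.lt_succ_self)
  have hsq : ∀ l, √(t l - t (l + 1)) ^ 2 = t l - t (l + 1) := fun l => Real.sq_sqrt (hdiff l).le
  obtain ⟨x, n, hx0, hn0, hn, hxU, hx1, hx2, hx3⟩ := h.exists_seq h0 ha hb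
    (s := fun l => √(t l - t (l + 1))) (β := fun l => ρ * t (l + 1))
    (γ := fun l => (1 - 3 * ρ) * t (l + 1)) (fun l => Real.sqrt_pos.2 (hdiff l))
    (fun l => mul_pos hρ (ht _)) (fun l => mul_pos (by linarith) (ht _)) hρ hlim
  simp only [hsq] at hx1 hx2
  have hdist : ∀ j l, j ≤ l → ‖x l - x j‖ ^ 2 ≤ (1 + ρ) * (t j - t l) := by
    intro j l hl
    induction l, hl using Nat.le_induction with
    | base => simp
    | succ l hl ih => linarith [hx1 l j hl]
  have hnorm : ∀ l, ‖x l‖ ^ 2 ≤ (1 + ρ) * t 0 := by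
    intro l
    have h1 := hdist 0 l (Nat.zero_le l)
    rw [hx0, sub_zero] at h1
    nlinarith [ht l]
  have hcauchy : CauchySeq x := by
    refine cauchySeq_of_le_tendsto_0' (fun l => √((1 + ρ) * t l)) (fun j l hl => ?_) ?_
    · rw [dist_comm, dist_eq_norm]
      apply Real.le_sqrt_of_sq_le
      nlinarith [hdist j l hl, ht l]
    · have h1 := (Real.continuous_sqrt.tendsto _).comp (ht0.const_mul (1 + ρ))
      simpa [Function.comp_def] using h1
  obtain ⟨y, hy⟩ := cauchySeq_tendsto_of_complete hcauchy
  refine ⟨y, mem_closure_of_tendsto hy (Eventually.of_forall hxU),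
    le_of_tendsto (hy.norm.pow 2) (Eventually.of_forall hnorm), fun k => ?_⟩
  obtain ⟨l, hl1, hl2⟩ : ∃ l, n l ≤ k ∧ k < n (l + 1) := by
    have hex : ∃ l, k < n l := ⟨k + 1, hn.le_apply⟩
    classical
    obtain ⟨m, hm⟩ : ∃ m, Nat.find hex = m + 1 :=
      Nat.exists_eq_succ_of_ne_zero fun h => by
        have := Nat.find_spec hex
        rw [h, hn0] at this
        omega
    refine ⟨m, ?_, hm ▸ Nat.find_spec hex⟩
    have := Nat.find_min hex (m := m) (by omega)
    omega
  have hl3 : -(ρ * t (l + 1)) ≤ (inner ℂ (x l) (R k (x l))).re ∧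
      a k < (1 - 3 * ρ) * t (l + 1) := by
    -- No time has been chosen for `x 0 = 0`, so the first block uses the uniform bound `ha1` on
    -- `a`.
    rcases l with _ | l
    · rw [hx0]
      have := mul_pos hρ (ht (0 + 1))
      exact ⟨by simp [this.le], ha1 k⟩
    · have h1 := hx3 l k hl1
      refine ⟨le_trans ?_ h1.1, h1.2.trans_le ?_⟩
      · exact le_rfl
      · exact le_rfl
  -- The step from `x l` to `x (l + 1)` is not controlled at these times `k`; it is merely short,
  -- and `htρ` makes its cross terms with `x l` small.
  have hl4 : (inner ℂ (x l) (R k (x l))).re - ρ * t (l + 1) ≤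
      (inner ℂ (x (l + 1)) (R k (x (l + 1)))).re := by
    refine le_trans ?_ (re_inner_apply_ge (hR k) (x l) (x (l + 1)))
    have hτ := ht (l + 1)
    have h1 := hdist l (l + 1) (Nat.le_succ l)
    have h2 := hnorm l
    have h3 := htρ l
    have h6 : t (l + 1) < t 0 := hanti (Nat.succ_pos l)
    have h4 : ‖x (l + 1) - x l‖ * ‖x l‖ ≤ 2 * (ρ * t (l + 1) / 10) := by
      apply le_of_sq_le_sq _ (by positivity)
      rw [mul_pow]
      calc ‖x (l + 1) - x l‖ ^ 2 * ‖x l‖ ^ 2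
          ≤ (2 * (t l - t (l + 1))) * (2 * t 0) := by
            have := hdiff l
            have := ht 0
            gcongr
            · nlinarith
            · nlinarith
        _ ≤ _ := by nlinarith
    have h5 : t l - t (l + 1) ≤ ρ * t (l + 1) / 100 := by
      by_contra! hc
      have h7 : ρ * t (l + 1) / 100 * t (l + 1) < (t l - t (l + 1)) * t 0 := by
        have : 0 < ρ * t (l + 1) / 100 := by positivity
        gcongr
      have h8 : (ρ * t (l + 1) / 10) ^ 2 ≤ ρ * t (l + 1) / 100 * t (l + 1) := by
        have h9 : 0 ≤ ρ * t (l + 1) / 100 * t (l + 1) := by positivity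
        nlinarith
      linarith
    nlinarith [hdiff l]
  have hl5 : ∀ J, l + 1 ≤ J → -(2 * ρ * t (l + 1)) + (1 - ρ) * (t (l + 1) - t J) ≤
      (inner ℂ (x J) (R k (x J))).re := by
    intro J hJ
    induction J, hJ using Nat.le_induction with
    | base => linarith [hl3.1]
    | succ J hJ ih =>
      have := hx2 J k (hl2.le.trans (hn.monotone hJ))
      linarith
  have hcont : Continuous fun z : H => (inner ℂ z (R k z)).re := by fun_prop
  have hl6 := le_of_tendsto_of_tendsto
    (((ht0.const_sub (t (l + 1))).const_mul (1 - ρ)).const_add (-(2 * ρ * t (l + 1))))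
    ((hcont.tendsto y).comp hy) (eventually_atTop.2 ⟨l + 1, hl5⟩)
  rw [sub_zero] at hl6
  linarith [hl3.2]

/-- Harmonic weights `S / (1 + κ * l)` work: their differences are quadratic in the weights, as
`htρ` demands; geometric decay would be too fast. -/
theorem IsApproxFixed.exists_slow (h : IsApproxFixed R F) (h0 : (0 : H) ∈ U)
    [CompleteSpace H] (hR : ∀ n x, ‖R n x‖ ≤ ‖x‖)
    (ha : ∀ u ∈ U, ∀ ε : ℝ, 0 < ε → ∀ᶠ n in atTop, -ε ≤ (inner ℂ u (R n u)).re)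
    (hb : ∀ u ∈ U, ∀ s : ℝ, 0 < s → ∃ᶠ w in F, u + (s : ℂ) • w ∈ U)
    {a : ℕ → ℝ} (hlim : Tendsto a atTop (𝓝 0)) {σ B : ℝ} (hσ : 0 < σ) (hB : 0 < B)
    (hσB : σ < B ^ 2) (ha1 : ∀ n, a n ≤ σ) :
    ∃ x ∈ closure U, ‖x‖ < B ∧ ∀ n, a n < (inner ℂ x (R n x)).re := by
  obtain ⟨S, hσS, hSB⟩ := exists_between hσB
  have hS : 0 < S := hσ.trans hσS
  have e1 : ∀ᶠ ρ in 𝓝[>] (0 : ℝ), (1 + ρ) * S < B ^ 2 := by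
    have hc : Continuous fun ρ : ℝ => (1 + ρ) * S := by fun_prop
    exact ((hc.tendsto 0).mono_left nhdsWithin_le_nhds).eventually_lt_const (by simpa using hSB)
  have e2 : ∀ᶠ ρ in 𝓝[>] (0 : ℝ), σ * (1 + ρ ^ 2 / 200) < (1 - 3 * ρ) * S := by
    have hc : Continuous fun ρ : ℝ => (1 - 3 * ρ) * S - σ * (1 + ρ ^ 2 / 200) := by fun_prop
    filter_upwards [((hc.tendsto 0).mono_left nhdsWithin_le_nhds).eventually_const_lt
      (show (0 : ℝ) < _ by simpa using hσS)] with ρ hρ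
    linarith
  have e3 : ∀ᶠ ρ in 𝓝[>] (0 : ℝ), ρ < 1 / 3 :=
    (Filter.Tendsto.mono_left tendsto_id nhdsWithin_le_nhds).eventually_lt_const (by norm_num)
  obtain ⟨ρ, hρ1, hρ2, hρ3, hρ⟩ := (e1.and (e2.and (e3.and self_mem_nhdsWithin))).exists
  have hρ : 0 < ρ := hρ
  -- Chosen so that `2 * κ = (ρ / 10) ^ 2`; the factor 2 bounds the ratio of consecutive weights.
  set κ := ρ ^ 2 / 200 with hκ
  have hκ0 : 0 < κ := by positivity
  have hκ1 : κ ≤ 1 := by rw [hκ]; nlinarith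
  have hden : ∀ l : ℕ, 0 < 1 + κ * l := fun l => by positivity
  have hanti : StrictAnti fun l : ℕ => S / (1 + κ * l) := by
    intro i j hij
    have : (i : ℝ) < j := by exact_mod_cast hij
    have := hden i
    dsimp only
    gcongr
  obtain ⟨x, hx, hx1, hx2⟩ := h.exists_slow_of_weights (t := fun l : ℕ => S / (1 + κ * l))
    h0 hR ha hb (fun l => div_pos hS (hden l)) hanti (by
      refine Tendsto.const_div_atTop ?_ S
      exact tendsto_atTop_add_const_left _ _
        (tendsto_natCast_atTop_atTop.const_mul_atTop hκ0)) hρ (by linarith) (by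
      intro l
      have h1 := hden l
      have h2 := hden (l + 1)
      have h3 : (S / (1 + κ * l) - S / (1 + κ * (l + 1 : ℕ))) * (S / (1 + κ * (0 : ℕ))) =
        κ * (S / (1 + κ * l)) * (S / (1 + κ * (l + 1 : ℕ))) := by
        push_cast at h2 ⊢
        field_simp
        ring
      have h4 : S / (1 + κ * l) ≤ 2 * (S / (1 + κ * (l + 1 : ℕ))) := by
        rw [← mul_div_assoc, div_le_div_iff₀ h1 h2]
        push_cast
        have : 0 ≤ κ * l := by positivity
        nlinarith
      rw [h3]
      have h5 : 0 < S / (1 + κ * (l + 1 : ℕ)) := div_pos hS h2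
      calc κ * (S / (1 + κ * l)) * (S / (1 + κ * (l + 1 : ℕ)))
          ≤ κ * (2 * (S / (1 + κ * (l + 1 : ℕ)))) * (S / (1 + κ * (l + 1 : ℕ))) := by gcongr
        _ = _ := by rw [hκ]; ring) hlim (fun n => (ha1 n).trans_lt (by
      rw [← mul_div_assoc, lt_div_iff₀ (hden 1)]
      simpa using hρ2))
  refine ⟨x, hx, lt_of_pow_lt_pow_left₀ 2 hB.le (hx1.trans_lt ?_), hx2⟩
  simpa using hρ1

end SlowVectors

/-! ### The Friedrichs number and norm reduction -/

section FriedrichsNumber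

variable {H : Type u} [NormedAddCommGroup H] [InnerProductSpace ℂ H]
variable {N : ℕ} (M : Fin N → ClosedSubmodule ℂ H)

theorem norm_sum_sq (m : Fin N → H) : ‖∑ j, m j‖ ^ 2 =
    ∑ j, ‖m j‖ ^ 2 + 2 * ∑ j, ∑ k ∈ Finset.Ioi j, (inner ℂ (m j) (m k)).re := by
  have h1 := Finset.sum_sum_Ioi_add_eq_sum_sum_off_diag
    (fun j k : Fin N => (inner ℂ (m j) (m k)).re)
  have h2 : ∀ j k, (inner ℂ (m j) (m k)).re + (inner ℂ (m k) (m j)).re =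
      2 * (inner ℂ (m k) (m j)).re := by
    intro j k
    have : (inner ℂ (m j) (m k)).re = (inner ℂ (m k) (m j)).re := inner_re_symm (𝕜 := ℂ) _ _
    rw [this]; ring
  simp only [h2, ← Finset.mul_sum] at h1
  rw [h1, ← Finset.sum_add_distrib, ← Complex.ofReal_re (‖∑ j, m j‖ ^ 2)]
  have h3 := inner_self_eq_norm_sq_to_K (𝕜 := ℂ) (∑ j, m j)
  have h4 : ∀ j, ‖m j‖ ^ 2 = (inner ℂ (m j) (m j)).re := by
    intro j
    rw [inner_self_eq_norm_sq_to_K]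
    norm_cast
  have h5 : ((‖∑ j, m j‖ ^ 2 : ℝ) : ℂ) = inner ℂ (∑ j, m j) (∑ j, m j) := by
    rw [h3]; norm_cast
  rw [h5, sum_inner, Complex.re_sum]
  simp only [inner_sum, Complex.re_sum, h4]
  rw [Finset.sum_comm]
  refine Finset.sum_congr rfl fun j _ => ?_
  rw [Fintype.sum_eq_add_sum_compl j, add_comm]

theorem norm_sum_sq_le (m : Fin N → H) : ‖∑ j, m j‖ ^ 2 ≤ N * ∑ j, ‖m j‖ ^ 2 := by
  calc ‖∑ j, m j‖ ^ 2 ≤ (∑ j, ‖m j‖) ^ 2 := by gcongr; exact norm_sum_le _ _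
    _ ≤ _ := by simpa using sq_sum_le_card_mul_sum_sq (s := Finset.univ) (f := fun j => ‖m j‖)

/-- The quotients whose supremum is the Friedrichs number. -/
def friedrichsSet : Set ℝ :=
  {r : ℝ | ∃ m : Fin N → H,
    (∀ j, m j ∈ M j ∧ m j ∈ (⨅ i, M i)ᗮ) ∧ ∑ j, ‖m j‖ ^ 2 ≠ 0 ∧
    r = 2 / ((N : ℝ) - 1) *
      ((∑ j, ∑ k ∈ Finset.Ioi j, (inner ℂ (m j) (m k)).re) / ∑ j, ‖m j‖ ^ 2)}

theorem friedrichsNumber_eq : friedrichsNumber M = sSup (friedrichsSet M) := rfl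

variable {M}

theorem exists_of_mem_friedrichsSet (hN : 2 ≤ N) {r : ℝ} (hr : r ∈ friedrichsSet M) :
    ∃ m : Fin N → H, (∀ j, m j ∈ M j ∧ m j ∈ (⨅ i, M i).toSubmoduleᗮ) ∧ 0 < ∑ j, ‖m j‖ ^ 2 ∧
      ‖∑ j, m j‖ ^ 2 = (1 + (N - 1) * r) * ∑ j, ‖m j‖ ^ 2 := by
  obtain ⟨m, hm, h0, rfl⟩ := hr
  have hN' : (2 : ℝ) ≤ N := by exact_mod_cast hN
  have hN1 : (N : ℝ) - 1 ≠ 0 := by linarith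
  refine ⟨m, hm, lt_of_le_of_ne (by positivity) h0.symm, ?_⟩
  rw [norm_sum_sq]
  field_simp

theorem bddAbove_friedrichsSet (hN : 2 ≤ N) : BddAbove (friedrichsSet M) := by
  refine ⟨1, fun r hr => ?_⟩
  obtain ⟨m, -, h0, h⟩ := exists_of_mem_friedrichsSet hN hr
  have hN' : (2 : ℝ) ≤ N := by exact_mod_cast hN
  have h1 := norm_sum_sq_le m
  rw [h] at h1
  have h2 := le_of_mul_le_mul_right h1 h0
  by_contra! hc
  nlinarith

theorem friedrichsNumber_lower (hN : 2 ≤ N) : 0 ≤ 1 + ((N : ℝ) - 1) * friedrichsNumber M := by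
  have hN' : (2 : ℝ) ≤ N := by exact_mod_cast hN
  rw [friedrichsNumber_eq]
  rcases (friedrichsSet M).eq_empty_or_nonempty with h | ⟨r, hr⟩
  · simp [h]
  · have h1 := le_csSup (bddAbove_friedrichsSet hN) hr
    obtain ⟨m, -, h0, h⟩ := exists_of_mem_friedrichsSet hN hr
    have h2 : 0 ≤ (1 + ((N : ℝ) - 1) * r) * ∑ j, ‖m j‖ ^ 2 := by rw [← h]; positivity
    have h3 := nonneg_of_mul_nonneg_left h2 h0
    nlinarith

theorem norm_sum_sq_le_friedrichsNumber (hN : 2 ≤ N) (m : Fin N → H)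
    (hm : ∀ j, m j ∈ M j ∧ m j ∈ (⨅ i, M i).toSubmoduleᗮ) :
    ‖∑ j, m j‖ ^ 2 ≤ (1 + ((N : ℝ) - 1) * friedrichsNumber M) * ∑ j, ‖m j‖ ^ 2 := by
  have hN' : (2 : ℝ) ≤ N := by exact_mod_cast hN
  have hN1 : (N : ℝ) - 1 ≠ 0 := by linarith
  by_cases h0 : ∑ j, ‖m j‖ ^ 2 = 0
  · have := norm_sum_sq_le m
    rwa [h0, mul_zero] at this ⊢
  · have h1 : 2 / ((N : ℝ) - 1) *
      ((∑ j, ∑ k ∈ Finset.Ioi j, (inner ℂ (m j) (m k)).re) / ∑ j, ‖m j‖ ^ 2) ≤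
        friedrichsNumber M := le_csSup (bddAbove_friedrichsSet hN) ⟨m, hm, h0, rfl⟩
    have h2 : ‖∑ j, m j‖ ^ 2 = (1 + ((N : ℝ) - 1) * (2 / ((N : ℝ) - 1) *
      ((∑ j, ∑ k ∈ Finset.Ioi j, (inner ℂ (m j) (m k)).re) / ∑ j, ‖m j‖ ^ 2))) *
        ∑ j, ‖m j‖ ^ 2 := by
      rw [norm_sum_sq]
      field_simp
    rw [h2]
    have : 0 ≤ (N : ℝ) - 1 := by linarith
    gcongr

variable [CompleteSpace H]

theorem proj_mem_orthogonal_iInf {x : H} (hx : x ∈ (⨅ i, M i).toSubmoduleᗮ) (j : Fin N) :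
    proj (M j) x ∈ (⨅ i, M i).toSubmoduleᗮ := by
  rw [Submodule.mem_orthogonal] at hx ⊢
  intro y hy
  have hyj : y ∈ M j := ClosedSubmodule.mem_iInf.1 hy j
  rw [← inner_proj, proj_eq_self hyj]
  exact hx y hy

/-- Apply the Friedrichs inequality to the vectors `proj (M j) x`. Their squared norms sum to S =
⟨x, ∑ P_j x⟩ ≤ ‖x‖ √(K S) with K = 1 + (N-1)c, so S ≤ K‖x‖², and N - K = (N-1)(1-c). -/
theorem sum_norm_sub_proj_sq_ge (hN : 2 ≤ N) {x : H} (hx : x ∈ (⨅ i, M i).toSubmoduleᗮ) :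
    ((N : ℝ) - 1) * (1 - friedrichsNumber M) * ‖x‖ ^ 2 ≤ ∑ j, ‖x - proj (M j) x‖ ^ 2 := by
  have hK := friedrichsNumber_lower (M := M) hN
  have h1 := norm_sum_sq_le_friedrichsNumber hN (fun j => proj (M j) x)
    fun j => ⟨proj_mem _ _, proj_mem_orthogonal_iInf hx j⟩
  set S := ∑ j, ‖proj (M j) x‖ ^ 2 with hS
  set K := 1 + ((N : ℝ) - 1) * friedrichsNumber M with hKdef
  have hS0 : 0 ≤ S := by positivity
  have h2 : S ≤ ‖x‖ * ‖∑ j, proj (M j) x‖ := by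
    have h3 : ((S : ℝ) : ℂ) = inner ℂ x (∑ j, proj (M j) x) := by
      rw [inner_sum, hS]
      push_cast
      refine Finset.sum_congr rfl fun j _ => ?_
      have := inner_self_eq_norm_sq_to_K (𝕜 := ℂ) (proj (M j) x)
      rw [inner_proj, proj_eq_self (proj_mem (M j) x)] at this
      rw [this]; rfl
    have h4 := norm_inner_le_norm (𝕜 := ℂ) x (∑ j, proj (M j) x)
    rwa [← h3, Complex.norm_real, Real.norm_of_nonneg hS0] at h4
  have h5 : S ≤ K * ‖x‖ ^ 2 := by
    rcases hS0.eq_or_lt with h | h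
    · rw [← h]; positivity
    · have h6 : S ^ 2 ≤ ‖x‖ ^ 2 * (K * S) := by
        calc S ^ 2 ≤ (‖x‖ * ‖∑ j, proj (M j) x‖) ^ 2 := by gcongr
          _ = ‖x‖ ^ 2 * ‖∑ j, proj (M j) x‖ ^ 2 := by ring
          _ ≤ _ := by gcongr
      refine le_of_mul_le_mul_right ?_ h
      linarith
  have h7 : ∑ j, ‖x - proj (M j) x‖ ^ 2 = N * ‖x‖ ^ 2 - S := by
    have : ∀ j, ‖x - proj (M j) x‖ ^ 2 = ‖x‖ ^ 2 - ‖proj (M j) x‖ ^ 2 := fun j => by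
      rw [norm_sq_eq_proj (M j) x]; ring
    simp only [this, Finset.sum_sub_distrib, hS]
    simp
  rw [h7]
  linarith [hKdef ▸ h5]

/-- The partial product ending with `proj (M j)` lies in `M j`, so it competes with the nearest
point, and its norm drop is at most the total one. -/
theorem norm_sub_proj_le_of_mem {l : List (Fin N)} {j : Fin N} (hj : j ∈ l) {x : H} {d : ℝ}
    (hd : 0 ≤ d) (h : ‖x‖ ^ 2 - ‖word M l x‖ ^ 2 ≤ d ^ 2) :
    ‖x - proj (M j) x‖ ≤ l.length * d := by
  obtain ⟨a, b, rfl⟩ := List.append_of_mem hj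
  have hmem : word M (j :: b) x ∈ M j := by
    rw [word_cons]
    exact proj_mem _ _
  have h1 : ‖word M (a ++ j :: b) x‖ ^ 2 ≤ ‖word M (j :: b) x‖ ^ 2 := by
    rw [word_append]
    gcongr
    exact norm_word_le _ _ _
  refine (norm_sub_proj_le _ _ hmem).trans
    ((norm_sub_word_le M (j :: b) hd (by linarith)).trans ?_)
  gcongr
  simp

theorem norm_word_sq_le (hN : 2 ≤ N) (hc : friedrichsNumber M ≤ 1) {l : List (Fin N)}
    (hl : ∀ j, j ∈ l) (hlen : l.length = N) {x : H} (hx : x ∈ (⨅ i, M i).toSubmoduleᗮ) :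
    ‖word M l x‖ ^ 2 ≤ (1 - ((1 - friedrichsNumber M) / (4 * (N : ℝ))) ^ 2) * ‖x‖ ^ 2 := by
  have hN' : (2 : ℝ) ≤ N := by exact_mod_cast hN
  have hK := friedrichsNumber_lower (M := M) hN
  set c := friedrichsNumber M
  have hw : ‖word M l x‖ ^ 2 ≤ ‖x‖ ^ 2 := by gcongr; exact norm_word_le _ _ _
  set D := ‖x‖ ^ 2 - ‖word M l x‖ ^ 2 with hD
  have hD0 : 0 ≤ D := sub_nonneg.2 hw
  have h1 := sum_norm_sub_proj_sq_ge hN hx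
  have h2 : ∑ j, ‖x - proj (M j) x‖ ^ 2 ≤ (N : ℝ) ^ 3 * D := by
    calc ∑ j, ‖x - proj (M j) x‖ ^ 2 ≤ ∑ _j : Fin N, (N * √D) ^ 2 := by
          gcongr with j
          rw [← hlen]
          exact norm_sub_proj_le_of_mem (hl j) (Real.sqrt_nonneg _) (Real.sq_sqrt hD0).ge
      _ = _ := by
          rw [mul_pow, Real.sq_sqrt hD0]
          simp
          ring
  have hc1 : -1 ≤ c := by nlinarith
  -- The left side is (1-c)²N/16, and (1-c)N ≤ 2N ≤ 16(N-1) because c ≥ -1 and N ≥ 2.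
  have h3 : ((1 - c) / (4 * (N : ℝ))) ^ 2 * (N : ℝ) ^ 3 ≤ ((N : ℝ) - 1) * (1 - c) := by
    have : ((1 - c) / (4 * (N : ℝ))) ^ 2 * (N : ℝ) ^ 3 = (1 - c) ^ 2 * N / 16 := by
      field_simp
      ring
    rw [this]
    have h4 : (1 - c) * ((1 - c) * N) ≤ (1 - c) * (16 * ((N : ℝ) - 1)) :=
      mul_le_mul_of_nonneg_left (by nlinarith) (by linarith)
    linarith
  have h5 : ((1 - c) / (4 * (N : ℝ))) ^ 2 * ‖x‖ ^ 2 ≤ D := by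
    have hN3 : (0 : ℝ) < (N : ℝ) ^ 3 := by positivity
    refine le_of_mul_le_mul_left ?_ hN3
    calc (N : ℝ) ^ 3 * (((1 - c) / (4 * (N : ℝ))) ^ 2 * ‖x‖ ^ 2)
        = ((1 - c) / (4 * (N : ℝ))) ^ 2 * (N : ℝ) ^ 3 * ‖x‖ ^ 2 := by ring
      _ ≤ ((N : ℝ) - 1) * (1 - c) * ‖x‖ ^ 2 := by gcongr
      _ ≤ _ := h1.trans h2
  linarith

/-! ### Convergence of powers, in norm and strongly -/

theorem word_proj_iInf (l : List (Fin N)) (x : H) :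
    word M l (proj (⨅ i, M i) x) = proj (⨅ i, M i) x :=
  word_eq_self M fun j _ => ClosedSubmodule.mem_iInf.1 (proj_mem _ x) j

theorem proj_iInf_word (l : List (Fin N)) (x : H) :
    proj (⨅ i, M i) (word M l x) = proj (⨅ i, M i) x := by
  refine ext_inner_right ℂ fun y => ?_
  rw [inner_proj, inner_word, word_proj_iInf, inner_proj]

theorem proj_mul_self (S : ClosedSubmodule ℂ H) : proj S * proj S = proj S := by
  ext x
  exact proj_eq_self (proj_mem S x)

theorem word_pow_sub_proj (l : List (Fin N)) {n : ℕ} (hn : 1 ≤ n) :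
    word M l ^ n - proj (⨅ i, M i) = (word M l - proj (⨅ i, M i)) ^ n := by
  have hWP : word M l * proj (⨅ i, M i) = proj (⨅ i, M i) := by
    ext x
    exact word_proj_iInf l x
  have hPW : proj (⨅ i, M i) * word M l = proj (⨅ i, M i) := by
    ext x
    exact proj_iInf_word l x
  have hPP := proj_mul_self (⨅ i, M i)
  induction n, hn using Nat.le_induction with
  | base => simp
  | succ n hn ih =>
    have h1 : word M l ^ n * proj (⨅ i, M i) = proj (⨅ i, M i) := by
      clear ih hn
      induction n with
      | zero => simp
      | succ n ih => rw [pow_succ, mul_assoc, hWP, ih]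
    rw [pow_succ (word M l - _), ← ih, sub_mul, mul_sub, mul_sub, h1, hPW, hPP, pow_succ]
    simp

theorem norm_word_pow_sub_proj_le (hN : 2 ≤ N) (hc : friedrichsNumber M ≤ 1)
    {l : List (Fin N)} (hl : ∀ j, j ∈ l) (hlen : l.length = N) {n : ℕ} (hn : 1 ≤ n) :
    ‖word M l ^ n - proj (⨅ j, M j)‖ ≤
      (1 - ((1 - friedrichsNumber M) / (4 * (N : ℝ))) ^ 2) ^ ((n : ℝ) / 2) := by
  have hN' : (2 : ℝ) ≤ N := by exact_mod_cast hN
  have hK := friedrichsNumber_lower (M := M) hN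
  have hc1 : -1 ≤ friedrichsNumber M := by nlinarith
  set b := 1 - ((1 - friedrichsNumber M) / (4 * (N : ℝ))) ^ 2 with hb
  have hb0 : 0 ≤ b := by
    have h1 : 0 ≤ (1 - friedrichsNumber M) / (4 * (N : ℝ)) := div_nonneg (by linarith) (by linarith)
    have h2 : (1 - friedrichsNumber M) / (4 * (N : ℝ)) ≤ 1 := by
      rw [div_le_one (by linarith)]
      linarith
    have h3 : ((1 - friedrichsNumber M) / (4 * (N : ℝ))) ^ 2 ≤ 1 := pow_le_one₀ h1 h2
    linarith
  have h1 : ‖word M l - proj (⨅ j, M j)‖ ≤ √b := by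
    refine ContinuousLinearMap.opNorm_le_bound _ (Real.sqrt_nonneg _) fun x => ?_
    have h2 := norm_word_sq_le hN hc hl hlen (sub_proj_mem (⨅ j, M j) x)
    rw [map_sub, word_proj_iInf] at h2
    have h3 := norm_sq_eq_proj (⨅ j, M j) x
    rw [sub_apply]
    apply le_of_sq_le_sq _ (by positivity)
    rw [mul_pow, Real.sq_sqrt hb0]
    refine h2.trans ?_
    gcongr
    simpa using norm_sub_proj_le (⨅ j, M j) x (zero_mem (⨅ j, M j))
  rw [word_pow_sub_proj l hn, div_eq_inv_mul, Real.rpow_mul_natCast hb0, ← one_div,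
    ← Real.sqrt_eq_rpow]
  exact (norm_pow_le' _ hn).trans (by gcongr)

theorem tendsto_word_pow (hN : 2 ≤ N) (hc : friedrichsNumber M < 1)
    {l : List (Fin N)} (hl : ∀ j, j ∈ l) (hlen : l.length = N) :
    Tendsto (fun n : ℕ => word M l ^ n) atTop (𝓝 (proj (⨅ j, M j))) := by
  have hN' : (2 : ℝ) ≤ N := by exact_mod_cast hN
  have hK := friedrichsNumber_lower (M := M) hN
  have hc1 : -1 ≤ friedrichsNumber M := by nlinarith
  have h1 : 0 < (1 - friedrichsNumber M) / (4 * (N : ℝ)) := div_pos (by linarith) (by linarith)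
  have h2 : (1 - friedrichsNumber M) / (4 * (N : ℝ)) < 1 := by
    rw [div_lt_one (by linarith)]
    linarith
  have h3 : ((1 - friedrichsNumber M) / (4 * (N : ℝ))) ^ 2 < 1 := pow_lt_one₀ h1.le h2 two_ne_zero
  rw [tendsto_iff_norm_sub_tendsto_zero]
  refine squeeze_zero' (Eventually.of_forall fun n => norm_nonneg _)
    (eventually_atTop.2 ⟨1, fun n hn => norm_word_pow_sub_proj_le hN hc.le hl hlen hn⟩) ?_
  have h4 := tendsto_rpow_atTop_of_base_lt_one
    (1 - ((1 - friedrichsNumber M) / (4 * (N : ℝ))) ^ 2) (by linarith) (by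
      have := pow_pos h1 2; linarith)
  exact h4.comp (tendsto_natCast_atTop_atTop.atTop_div_const two_pos)

/-- With W the word, the vectors where convergence holds form a closed subspace containing M and the
range of 1 - W, since the norm drops along W^n y tend to zero. A vector orthogonal to that range is
fixed by the reversed word W*; without norm drop it lies in every `M j`, hence in M. -/
theorem tendsto_word_pow_apply {l : List (Fin N)} (hl : ∀ j, j ∈ l) (x : H) :
    Tendsto (fun n : ℕ => (word M l ^ n) x) atTop (𝓝 (proj (⨅ j, M j) x)) := by
  let V : Submodule ℂ H :=
    { carrier := {x | Tendsto (fun n : ℕ => (word M l ^ n) x) atTop (𝓝 (proj (⨅ j, M j) x))}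
      add_mem' := fun {x y} hx hy => by simpa using Tendsto.add hx hy
      zero_mem' := by simp
      smul_mem' := fun c x hx => by
        change Tendsto _ _ _
        simp only [map_smul]
        exact Tendsto.const_smul hx c }
  have hpow : ∀ (n : ℕ) (x : H), ‖(word M l ^ n) x‖ ≤ ‖x‖ := by
    intro n x
    induction n with
    | zero => simp
    | succ n ih =>
      rw [pow_succ']
      exact (norm_word_le M l _).trans ih
  have hclosed : IsClosed (V : Set H) := by
    rw [← isSeqClosed_iff_isClosed]
    intro v x hv hx
    refine Metric.tendsto_atTop.2 fun ε hε => ?_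
    obtain ⟨k, hk⟩ := ((Metric.tendsto_nhds.1 hx) (ε / 4) (by positivity)).exists
    obtain ⟨n₀, hn₀⟩ := Metric.tendsto_atTop.1 (hv k) (ε / 2) (by positivity)
    refine ⟨n₀, fun n hn => ?_⟩
    have h1 := hn₀ n hn
    rw [dist_eq_norm] at hk h1 ⊢
    have h2 := hpow n (v k - x)
    have h3 := norm_proj_le (⨅ j, M j) (v k - x)
    rw [map_sub] at h2 h3
    have h4 : (word M l ^ n) x - proj (⨅ j, M j) x =
        ((word M l ^ n) (v k) - proj (⨅ j, M j) (v k)) -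
          ((word M l ^ n) (v k) - (word M l ^ n) x) +
            (proj (⨅ j, M j) (v k) - proj (⨅ j, M j) x) := by abel
    rw [h4]
    refine (norm_add_le _ _).trans_lt ?_
    linarith [norm_sub_le ((word M l ^ n) (v k) - proj (⨅ j, M j) (v k))
      ((word M l ^ n) (v k) - (word M l ^ n) x)]
  have hfix : ∀ x ∈ ⨅ j, M j, x ∈ V := by
    intro x hx
    have h1 : ∀ n, (word M l ^ n) x = x := by
      intro n
      induction n with
      | zero => simp
      | succ n ih =>
        rw [pow_succ', mul_apply_eq_comp, ih,
          word_eq_self M fun j _ => ClosedSubmodule.mem_iInf.1 hx j]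
    change Tendsto _ _ _
    simp only [h1, proj_eq_self hx]
    exact tendsto_const_nhds
  have hran : ∀ y, y - word M l y ∈ V := by
    intro y
    change Tendsto _ _ _
    rw [map_sub, proj_iInf_word, sub_self]
    have hstep : ∀ n, (word M l ^ (n + 1)) y = word M l ((word M l ^ n) y) := fun n => by
      rw [pow_succ']; rfl
    have hanti : Antitone fun n : ℕ => ‖(word M l ^ n) y‖ ^ 2 := by
      refine antitone_nat_of_succ_le fun n => ?_
      rw [hstep]
      gcongr
      exact norm_word_le _ _ _
    have hlim := tendsto_atTop_ciInf hanti ⟨0, by rintro _ ⟨n, rfl⟩; positivity⟩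
    have h1 := hlim.sub (hlim.comp (tendsto_add_atTop_nat 1))
    have h2 := ((Real.continuous_sqrt.tendsto _).comp h1).const_mul (l.length : ℝ)
    simp only [sub_self, Real.sqrt_zero, mul_zero, Function.comp_def] at h2
    refine squeeze_zero_norm (fun n => ?_) h2
    have h3 : (word M l ^ n) (y - word M l y) =
        (word M l ^ n) y - word M l ((word M l ^ n) y) := by
      rw [map_sub, ← hstep, pow_succ]; rfl
    rw [h3]
    refine norm_sub_word_le M l (Real.sqrt_nonneg _) ?_
    rw [← hstep]
    exact (Real.sq_sqrt (sub_nonneg.2 (hanti n.le_succ))).ge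
  have : CompleteSpace V := hclosed.completeSpace_coe
  have htop : V = ⊤ := by
    rw [← Submodule.orthogonal_eq_bot_iff, eq_bot_iff]
    intro x hx
    have h1 : word M l.reverse x = x := by
      refine ext_inner_left ℂ fun y => ?_
      have h2 := (Submodule.mem_orthogonal _ _).1 hx _ (hran y)
      rw [inner_sub_left, inner_word, sub_eq_zero] at h2
      exact h2.symm
    refine inner_self_eq_zero.1 ((Submodule.mem_orthogonal _ _).1 hx x (hfix x ?_))
    refine ClosedSubmodule.mem_iInf.2 fun j => ?_
    have h3 := norm_sub_proj_le_of_mem (M := M) (List.mem_reverse.2 (hl j)) (x := x) le_rfl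
      (by rw [h1]; simp)
    rw [mul_zero, norm_le_zero_iff, sub_eq_zero] at h3
    rw [h3]
    exact proj_mem _ _
  have : x ∈ V := by rw [htop]; trivial
  exact this

/-! ### Approximately fixed vectors when the Friedrichs number is one -/

/-- Take the mean y of a nearly extremal family m_j and normalize it. The variance ∑‖y - m_j‖² =
∑‖m_j‖² - N‖y‖² is small, so y is close to each m_j ∈ M_j. -/
theorem exists_approxFixed (hN : 2 ≤ N) (hc : friedrichsNumber M = 1) {ε : ℝ} (hε : 0 < ε) :
    ∃ x ∈ (⨅ i, M i).toSubmoduleᗮ, ‖x‖ = 1 ∧ ∀ j, ‖proj (M j) x - x‖ < ε := by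
  have hN' : (2 : ℝ) ≤ N := by exact_mod_cast hN
  have hne : (friedrichsSet M).Nonempty := by
    rw [Set.nonempty_iff_ne_empty]
    intro h
    rw [friedrichsNumber_eq, h, Real.sSup_empty] at hc
    exact zero_ne_one hc
  -- From ‖y - m_j‖² ≤ ηS and N‖y‖² ≥ (1-η)S, what is needed is Nη < ε²(1-η).
  set η := ε ^ 2 / (N + ε ^ 2) / 2 with hη
  have hη0 : 0 < η := by positivity
  have hη1 : η * (N + ε ^ 2) < ε ^ 2 := by
    have : η * (N + ε ^ 2) = ε ^ 2 / 2 := by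
      rw [hη]; field_simp
    rw [this]
    have : 0 < ε ^ 2 := by positivity
    linarith
  obtain ⟨r, hr, hr1⟩ := exists_lt_of_lt_csSup hne
    (show 1 - η < sSup (friedrichsSet M) by rw [← friedrichsNumber_eq, hc]; linarith)
  obtain ⟨m, hm, hS, h⟩ := exists_of_mem_friedrichsSet hN hr
  set S := ∑ j, ‖m j‖ ^ 2
  set y : H := ((N : ℝ)⁻¹ : ℂ) • ∑ j, m j with hy
  have hynorm : (N : ℝ) * ‖y‖ ^ 2 = ‖∑ j, m j‖ ^ 2 / N := by
    rw [hy, norm_smul, mul_pow, norm_inv, Complex.norm_real, Real.norm_of_nonneg (by linarith)]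
    field_simp
  have hsum : ∑ j, ‖y - m j‖ ^ 2 = S - N * ‖y‖ ^ 2 := by
    have h1 : ∀ j, ‖y - m j‖ ^ 2 = ‖y‖ ^ 2 - 2 * (inner ℂ y (m j)).re + ‖m j‖ ^ 2 := fun j =>
      norm_sub_sq (𝕜 := ℂ) y (m j)
    have h2 : ∑ j, (inner ℂ y (m j)).re = N * ‖y‖ ^ 2 := by
      rw [← Complex.re_sum, ← inner_sum]
      have h3 : ∑ j, m j = ((N : ℝ) : ℂ) • y := by
        rw [hy, smul_smul, mul_inv_cancel₀ (by exact_mod_cast (by omega : N ≠ 0)), one_smul]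
      rw [h3, inner_smul_right, inner_self_eq_norm_sq_to_K, Complex.re_ofReal_mul]
      norm_cast
    simp only [h1, Finset.sum_add_distrib, Finset.sum_sub_distrib, ← Finset.mul_sum, h2]
    simp
    ring
  have hlow : (1 - η) * S ≤ N * ‖y‖ ^ 2 := by
    rw [hynorm, h, le_div_iff₀ (by linarith)]
    have : (1 - η) * N ≤ 1 + (N - 1) * r := by nlinarith
    nlinarith
  have hdist : ∀ j, ‖y - m j‖ ^ 2 ≤ η * S := by
    intro j
    have := Finset.single_le_sum (f := fun j => ‖y - m j‖ ^ 2) (fun _ _ => by positivity)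
      (Finset.mem_univ j)
    linarith
  have hlt : ∀ j, ‖proj (M j) y - y‖ < ε * ‖y‖ := by
    intro j
    rw [norm_sub_rev]
    refine (norm_sub_proj_le _ _ (hm j).1).trans_lt (lt_of_pow_lt_pow_left₀ 2 (by positivity) ?_)
    rw [mul_pow]
    have h1 : N * (η * S) < N * (ε ^ 2 * ‖y‖ ^ 2) := by
      have h2 : η * (N + ε ^ 2) * S < ε ^ 2 * S := by gcongr
      have h3 : ε ^ 2 * ((1 - η) * S) ≤ ε ^ 2 * (N * ‖y‖ ^ 2) := by gcongr
      linarith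
    exact (hdist j).trans_lt (lt_of_mul_lt_mul_left h1 (by linarith))
  have hy0 : 0 < ‖y‖ := by
    have := (norm_nonneg _).trans_lt (hlt ⟨0, by omega⟩)
    exact pos_of_mul_pos_right this hε.le
  refine ⟨((‖y‖⁻¹ : ℝ) : ℂ) • y, ?_, ?_, fun j => ?_⟩
  · exact Submodule.smul_mem _ _ (Submodule.smul_mem _ _ (Submodule.sum_mem _ fun j _ => (hm j).2))
  · rw [norm_smul, Complex.norm_real, norm_inv, norm_norm, inv_mul_cancel₀ hy0.ne']
  · rw [map_smul, ← smul_sub, norm_smul, Complex.norm_real, norm_inv, norm_norm,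
      inv_mul_lt_iff₀ hy0, mul_comm]
    exact hlt j

variable (M)

/-- The filter of unit vectors orthogonal to `⨅ i, M i` that are almost fixed by all projections. -/
noncomputable def approxFixed : Filter H :=
  comap (fun (w : H) (j : Fin N) => proj (M j) w - w) (𝓝 0) ⊓
    𝓟 {w | w ∈ (⨅ i, M i).toSubmoduleᗮ ∧ ‖w‖ = 1}

theorem approxFixed_neBot (hN : 2 ≤ N) (hc : friedrichsNumber M = 1) : (approxFixed M).NeBot := by
  rw [approxFixed, inf_principal_neBot_iff]
  intro V hV
  obtain ⟨ε, hε, h⟩ := (Metric.nhds_basis_ball.comap _).mem_iff.1 hV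
  obtain ⟨x, hx, hx1, hx2⟩ := exists_approxFixed hN hc hε
  refine ⟨x, h ?_, hx, hx1⟩
  rw [Set.mem_preimage, mem_ball_zero_iff, pi_norm_lt_iff hε]
  exact hx2

theorem approxFixed_eventually :
    ∀ᶠ w in approxFixed M, w ∈ (⨅ i, M i).toSubmoduleᗮ ∧ ‖w‖ = 1 :=
  mem_inf_of_right (mem_principal_self _)

theorem tendsto_proj_sub_approxFixed (j : Fin N) :
    Tendsto (fun w => proj (M j) w - w) (approxFixed M) (𝓝 0) :=
  ((tendsto_pi_nhds.1 (tendsto_comap (f := fun (w : H) (j : Fin N) => proj (M j) w - w)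
    (x := 𝓝 0))) j).mono_left inf_le_left

theorem isApproxFixed_approxFixed (i : ℕ → Fin N) :
    IsApproxFixed (randomProduct M i) (approxFixed M) where
  tendsto_norm := tendsto_const_nhds.congr' <| by
    filter_upwards [approxFixed_eventually M] with w hw using hw.2.symm
  tendsto_inner := by
    intro v
    suffices hV : weakNull (approxFixed M) id = ⊤ by
      change v ∈ weakNull (approxFixed M) id
      rw [hV]
      trivial
    refine submodule_eq_top M (A := Finset.univ) (isClosed_weakNull (C := 1) ?_) ?_ ?_
    · filter_upwards [approxFixed_eventually M] with w hw using hw.2.le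
    · intro x hx
      rw [inter_univ] at hx
      rw [mem_weakNull]
      refine tendsto_const_nhds.congr' ?_
      filter_upwards [approxFixed_eventually M] with w hw
      exact ((Submodule.mem_orthogonal' _ _).1 hw.1 x hx).symm
    · intro j _ x hx
      rw [mem_weakNull]
      have h1 := (tendsto_proj_sub_approxFixed M j).inner (tendsto_const_nhds (x := x)) (𝕜 := ℂ)
      have h2 := h1.neg
      simp only [inner_sub_left, inner_eq_zero_of_mem (proj_mem (M j) _) hx] at h2
      simpa using h2
  tendsto_sub := by
    intro n
    obtain ⟨l, -, hl⟩ := randomProduct_eq_word M i 0 n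
    simp only [zero_add] at hl
    simp only [hl]
    exact tendsto_word_sub M (tendsto_proj_sub_approxFixed M) l

end FriedrichsNumber

/-! ### Implications between the forms of slow convergence -/

section Transfer

variable {H : Type u} [NormedAddCommGroup H] [InnerProductSpace ℂ H]

theorem ASC1.asc2 {X : Type u} [NormedAddCommGroup X] [NormedSpace ℂ X] {T Tinf : X →L[ℂ] X}
    (hlim : ∀ x, Tendsto (fun n : ℕ => (T ^ n) x) atTop (𝓝 (Tinf x))) (h : ASC1 T Tinf) :
    ASC2 T Tinf := by
  intro a ha ha0
  rw [Metric.dense_iff]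
  intro x₀ r hr
  have hu : Tendsto (fun n : ℕ+ => ‖(T ^ (n : ℕ)) x₀ - Tinf x₀‖) atTop (𝓝 0) :=
    (tendsto_iff_norm_sub_tendsto_zero.1 (hlim x₀)).comp tendsto_PNat_val_atTop_atTop
  have hb := ha0.add hu
  rw [add_zero] at hb
  have hr4 : 0 < r / 4 := by positivity
  obtain ⟨z, hz, hz1⟩ := h (r / 4) hr4
    -- Truncation at `r / 4` keeps the perturbation `z` inside the ball and is inactive for large
    -- `n`; the added error of `x₀` compensates for possible cancellation.
    (fun n => min (a n + ‖(T ^ (n : ℕ)) x₀ - Tinf x₀‖) (r / 4))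
    (fun n => lt_min (add_pos_of_pos_of_nonneg (ha n) (norm_nonneg _)) hr4)
    (by simpa [min_eq_left hr4.le] using hb.min (tendsto_const_nhds (x := r / 4)))
  have hsup : ⨆ n : ℕ+, min (a n + ‖(T ^ (n : ℕ)) x₀ - Tinf x₀‖) (r / 4) ≤ r / 4 :=
    ciSup_le fun n => min_le_right _ _
  refine ⟨x₀ + z, ?_, ?_⟩
  · rw [mem_ball_iff_norm, add_sub_cancel_left]
    linarith
  · obtain ⟨n₀, hn₀⟩ := eventually_atTop.1 (hb.eventually_le_const hr4)
    refine (Set.finite_Iio n₀).subset fun n hn => ?_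
    by_contra hc
    refine hn ?_
    have h1 := hz1 n
    rw [min_eq_left (hn₀ n (by simpa using hc))] at h1
    have h2 : (T ^ (n : ℕ)) z - Tinf z = ((T ^ (n : ℕ)) (x₀ + z) - Tinf (x₀ + z)) -
        ((T ^ (n : ℕ)) x₀ - Tinf x₀) := by
      rw [map_add, map_add]; abel
    have h3 := norm_sub_le ((T ^ (n : ℕ)) (x₀ + z) - Tinf (x₀ + z)) ((T ^ (n : ℕ)) x₀ - Tinf x₀)
    rw [← h2] at h3
    linarith

/-- By Cauchy–Schwarz the rescaled vector `‖x‖ • x` works, of norm `‖x‖ ^ 2`. -/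
theorem ASCH.asc1 {T Tinf : H →L[ℂ] H} (h : ASCH T Tinf) : ASC1 T Tinf := by
  intro ε hε a ha ha0
  set σ := ⨆ n, a n with hσ
  have hσ0 : 0 ≤ σ := Real.iSup_nonneg fun n => (ha n).le
  have hδ : ∀ᶠ δ in 𝓝[>] (0 : ℝ), (√σ + δ) ^ 2 < σ + ε := by
    have hc : Continuous fun δ : ℝ => (√σ + δ) ^ 2 := by fun_prop
    refine ((hc.tendsto 0).mono_left nhdsWithin_le_nhds).eventually_lt_const ?_
    rw [add_zero, Real.sq_sqrt hσ0]
    linarith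
  obtain ⟨δ, hδ1, hδ0⟩ := (hδ.and self_mem_nhdsWithin).exists
  have hδ0 : 0 < δ := hδ0
  obtain ⟨x, hx, hx1⟩ := h δ hδ0 a ha ha0
  refine ⟨(‖x‖ : ℂ) • x, ?_, fun n => ?_⟩
  · rw [norm_smul, Complex.norm_real, norm_norm, ← sq]
    exact (pow_lt_pow_left₀ hx (norm_nonneg _) two_ne_zero).trans hδ1
  · rw [map_smul, map_smul, ← smul_sub, norm_smul, Complex.norm_real, norm_norm]
    exact (hx1 n).trans (re_inner_le_norm (𝕜 := ℂ) _ _)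

theorem exists_dual_repr [CompleteSpace H] {Y : Type v} [NormedAddCommGroup Y] [NormedSpace ℂ Y]
    (ι : H →ₗᵢ[ℂ] StrongDual ℂ Y) (y : Y) :
    ∃ g : H, ‖g‖ ≤ ‖y‖ ∧ ∀ z, inner ℂ g z = ι z y := by
  let φ : StrongDual ℂ H := (ContinuousLinearMap.apply ℂ ℂ y).comp ι.toContinuousLinearMap
  have hφ : ∀ z, inner ℂ ((InnerProductSpace.toDual ℂ H).symm φ) z = ι z y := fun z =>
    InnerProductSpace.toDual_symm_apply
  refine ⟨(InnerProductSpace.toDual ℂ H).symm φ, ?_, hφ⟩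
  rw [LinearIsometryEquiv.norm_map]
  refine ContinuousLinearMap.opNorm_le_bound _ (norm_nonneg _) fun z => ?_
  have := (ι z).le_opNorm y
  rw [ι.norm_map, mul_comm] at this
  exact this

/-- Rotate and scale to ‖f‖/2 a vector of the unit ball of `Y` on which `ι f` exceeds ‖f‖/2. The
vector of `H` representing it leaves a remainder of squared norm at most 3/4 ‖f‖² < (7/8)² ‖f‖². -/
theorem exists_approx_dual_repr [CompleteSpace H] {Y : Type v} [NormedAddCommGroup Y]
    [NormedSpace ℂ Y] (ι : H →ₗᵢ[ℂ] StrongDual ℂ Y) (f : H) :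
    ∃ (y : Y) (g : H), ‖y‖ ≤ ‖f‖ ∧ ‖g‖ ≤ 7 / 8 * ‖f‖ ∧ ∀ z, inner ℂ (f - g) z = ι z y := by
  rcases eq_or_ne f 0 with rfl | hf
  · exact ⟨0, 0, by simp⟩
  have hf0 : 0 < ‖f‖ := norm_pos_iff.2 hf
  obtain ⟨y₀, hy₀, hlt⟩ := (ι f).exists_lt_apply_of_lt_opNorm (r := ‖f‖ / 2)
    (by rw [ι.norm_map]; linarith)
  obtain ⟨c, hc, hcι⟩ := Complex.exists_norm_eq_mul_self (ι f y₀)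
  set y : Y := ((‖f‖ / 2 : ℝ) : ℂ) • c • y₀ with hy
  have hynorm : ‖y‖ ≤ ‖f‖ / 2 := by
    rw [hy, norm_smul, norm_smul, hc, Complex.norm_real, Real.norm_of_nonneg (by positivity),
      one_mul]
    exact mul_le_of_le_one_right (by positivity) hy₀.le
  obtain ⟨g, hg, hgz⟩ := exists_dual_repr ι y
  refine ⟨y, f - g, by linarith, ?_, fun z => by rw [sub_sub_cancel, hgz]⟩
  have h1 : (inner ℂ f g).re = ‖f‖ / 2 * ‖ι f y₀‖ := by
    have h2 : inner ℂ g f = ((‖f‖ / 2 : ℝ) : ℂ) * (‖ι f y₀‖ : ℂ) := by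
      rw [hgz, hy, map_smul, map_smul, smul_eq_mul, smul_eq_mul, ← hcι]
    have h3 : (inner ℂ f g).re = (inner ℂ g f).re := inner_re_symm (𝕜 := ℂ) _ _
    rw [h3, h2, Complex.re_ofReal_mul, Complex.ofReal_re]
  have h4 : ‖f - g‖ ^ 2 = ‖f‖ ^ 2 - 2 * (inner ℂ f g).re + ‖g‖ ^ 2 :=
    norm_sub_sq (𝕜 := ℂ) f g
  have h5 : ‖g‖ ^ 2 ≤ (‖f‖ / 2) ^ 2 := by gcongr; exact hg.trans hynorm
  apply le_of_sq_le_sq _ (by positivity)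
  rw [h4, h1]
  nlinarith

/-- Iterating the approximate representation on the remainders gives a geometric series, which
converges since `Y` is complete. -/
theorem exists_eq_dual [CompleteSpace H] {Y : Type v} [NormedAddCommGroup Y]
    [NormedSpace ℂ Y] [CompleteSpace Y] (ι : H →ₗᵢ[ℂ] StrongDual ℂ Y) (x : H) :
    ∃ y : Y, ∀ z, ι z y = inner ℂ x z := by
  choose y g hy hg hyg using exists_approx_dual_repr ι
  let f : ℕ → H := fun n => g^[n] x
  have hf : ∀ n, f (n + 1) = g (f n) := fun n => Function.iterate_succ_apply' g n x
  have hnorm : ∀ n, ‖f n‖ ≤ (7 / 8) ^ n * ‖x‖ := by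
    intro n
    induction n with
    | zero => simp [f]
    | succ n ih =>
      rw [hf, pow_succ]
      linarith [hg (f n)]
  have hsum : Summable fun n => y (f n) := by
    refine Summable.of_norm_bounded (g := fun n => (7 / 8) ^ n * ‖x‖)
      ((summable_geometric_of_lt_one (by norm_num) (by norm_num)).mul_right _)
      fun n => (hy _).trans (hnorm n)
  have hf0 : Tendsto f atTop (𝓝 0) := by
    refine squeeze_zero_norm hnorm ?_
    simpa using (tendsto_pow_atTop_nhds_zero_of_lt_one (by norm_num : (0 : ℝ) ≤ 7 / 8)
      (by norm_num)).mul_const ‖x‖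
  refine ⟨∑' n, y (f n), fun z => ?_⟩
  have h1 := (((ι z).continuous.tendsto _).comp hsum.hasSum.tendsto_sum_nat)
  have h2 : ∀ n, ι z (∑ k ∈ Finset.range n, y (f k)) = inner ℂ (x - f n) z := by
    intro n
    rw [map_sum]
    simp only [← hyg, ← hf]
    rw [← sum_inner, Finset.sum_range_sub']
    rfl
  simp only [Function.comp_def, h2] at h1
  refine tendsto_nhds_unique h1 ?_
  simpa [inner_sub_left] using (hf0.const_sub x).inner (tendsto_const_nhds (x := z)) (𝕜 := ℂ)

theorem ASCH.asc3 [CompleteSpace H] {T Tinf : H →L[ℂ] H} (h : ASCH T Tinf) :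
    ASC3.{u, v} T Tinf := by
  intro a ha ha0
  obtain ⟨x, -, hx⟩ := h 1 one_pos a ha ha0
  refine ⟨x, ⟨innerSL ℂ x, fun n => ?_⟩, fun Y _ _ _ ι => ?_⟩
  · rw [innerSL_apply_apply]
    exact hx n
  · obtain ⟨y, hy⟩ := exists_eq_dual ι x
    refine ⟨y, fun n => ?_⟩
    rw [hy]
    exact hx n

end Transfer

/-! ### Slow convergence of random and cyclic products -/

section Random

variable {H : Type u} [NormedAddCommGroup H] [InnerProductSpace ℂ H] [CompleteSpace H]
variable {N : ℕ} {M : Fin N → ClosedSubmodule ℂ H}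

theorem mem_orthogonal_iInf_of_mem_inter {A : Finset (Fin N)} {x : H}
    (hx : x ∈ (inter M A).toSubmoduleᗮ) : x ∈ (⨅ j, M j).toSubmoduleᗮ :=
  Submodule.orthogonal_le (fun _ hy =>
    (mem_inter M).2 fun j _ => ClosedSubmodule.mem_iInf.1 hy j) hx

theorem exists_slow_randomProduct (hN : 2 ≤ N) (hc : friedrichsNumber M = 1) (i : ℕ → Fin N)
    {a : ℕ → ℝ} (hlim : Tendsto a atTop (𝓝 0)) {σ B : ℝ} (hσ : 0 < σ) (hB : 0 < B)
    (hσB : σ < B ^ 2) (ha1 : ∀ n, a n ≤ σ) :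
    ∃ x ∈ (⨅ j, M j).toSubmoduleᗮ, ‖x‖ < B ∧
      ∀ n, a n < (inner ℂ x (randomProduct M i n x)).re := by
  have := approxFixed_neBot M hN hc
  have hF := isApproxFixed_approxFixed M i
  obtain ⟨A, m, hA⟩ := exists_tendsto_inner_randomProduct M i
  set Q := proj (inter M A) with hQ
  set R := randomProduct M i with hRdef
  have hR : ∀ n x, ‖R n x‖ ≤ ‖x‖ := norm_randomProduct_le M i
  have hlow : ∀ u : H, 0 ≤ (inner ℂ (Q u) (R m u)).re → ∀ ε : ℝ, 0 < ε →
      ∀ᶠ n in atTop, -ε ≤ (inner ℂ u (R n u)).re := by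
    intro u hu ε hε
    have h1 := (Complex.continuous_re.tendsto _).comp (hA u u)
    have h2 : (inner ℂ (Q (R m u)) u).re = (inner ℂ (Q u) (R m u)).re := by
      rw [inner_proj]
      exact inner_re_symm (𝕜 := ℂ) _ _
    rw [h2] at h1
    filter_upwards [h1.eventually_const_le (show -ε < _ by linarith)] with n hn
    exact hn.trans (inner_re_symm (𝕜 := ℂ) _ _).le
  have hQR : ∀ w : H, (inner ℂ (Q w) (R m w)).re =
      ‖Q w‖ ^ 2 + (inner ℂ (Q w) (R m w - w)).re := by
    intro w
    have h1 : ((‖Q w‖ ^ 2 : ℝ) : ℂ) = inner ℂ (Q w) w := by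
      have := inner_self_eq_norm_sq_to_K (𝕜 := ℂ) (Q w)
      rw [← inner_proj, proj_eq_self (proj_mem _ w)] at this
      rw [this]
      norm_cast
    have h2 : ‖Q w‖ ^ 2 = (inner ℂ (Q w) w).re := by rw [← h1, Complex.ofReal_re]
    rw [h2, inner_sub_right, Complex.sub_re]
    ring
  have hclosure : ∀ {U : Set H}, U ⊆ (⨅ j, M j).toSubmoduleᗮ → ∀ x ∈ closure U,
      x ∈ (⨅ j, M j).toSubmoduleᗮ := fun hU x hx =>
    closure_minimal hU (Submodule.isClosed_orthogonal _) hx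
  -- The weak limit of Re⟨R_n u, u⟩ is Re⟨Q u, R_m u⟩, so partial sums must keep this form
  -- nonnegative. In the first case strict positivity can be created from zero, and it then survives
  -- small losses.
  by_cases hcase : ∃ᶠ w in approxFixed M, 0 < (inner ℂ (Q w) (R m w)).re
  · let U : Set H := {u | u = 0 ∨ (u ∈ (⨅ j, M j).toSubmoduleᗮ ∧ 0 < (inner ℂ (Q u) (R m u)).re)}
    obtain ⟨x, hx, hx1, hx2⟩ := hF.exists_slow (U := U) (Or.inl rfl) hR (by
        rintro u (rfl | hu)
        · exact hlow 0 (by simp)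
        · exact hlow u hu.2.le) (by
        rintro u (rfl | hu) s hs
        · refine (hcase.and_eventually (approxFixed_eventually M)).mono fun w hw => Or.inr ⟨?_, ?_⟩
          · exact Submodule.add_mem _ (Submodule.zero_mem _) (Submodule.smul_mem _ _ hw.2.1)
          · simp only [zero_add, map_smul, inner_smul_left, inner_smul_right, Complex.conj_ofReal,
              Complex.re_ofReal_mul]
            exact mul_pos hs (mul_pos hs hw.1)
        -- The cross terms vanish along the filter, and the form of `w` itself is at least `-(‖w‖ *
        -- ‖R m w - w‖)`, which tends to zero; positivity persists eventually.
        · have h1 := hF.tendsto_re_inner (Q u)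
          have h2 : Tendsto (fun w => (inner ℂ (Q u) (R m w - w)).re) (approxFixed M) (𝓝 0) := by
            have : Continuous fun z : H => (inner ℂ (Q u) z).re := by fun_prop
            simpa [Function.comp_def] using (this.tendsto 0).comp (hF.tendsto_sub m)
          have h3 := (Complex.continuous_re.tendsto _).comp (hF.tendsto_inner (Q (R m u)))
          have h4 := (hF.tendsto_norm.mul (hF.tendsto_sub m).norm)
          have h5 := (((((h1.add h2).const_mul s).add (h3.const_mul s)).sub
            (h4.const_mul (s ^ 2))).const_add (inner ℂ (Q u) (R m u)).re)
          simp only [norm_zero, mul_zero, add_zero, sub_zero, Complex.zero_re] at h5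
          refine Eventually.frequently ?_
          filter_upwards [h5.eventually_const_lt hu.2, approxFixed_eventually M] with w hw hw1
          refine Or.inr ⟨Submodule.add_mem _ hu.1 (Submodule.smul_mem _ _ hw1.1), hw.trans_le ?_⟩
          have h6 := hQR w
          have h7 : -(‖w‖ * ‖R m w - w‖) ≤ (inner ℂ (Q w) (R m w - w)).re := by
            have h8 := Complex.abs_re_le_norm (inner ℂ (Q w) (R m w - w))
            have h9 := norm_inner_le_norm (𝕜 := ℂ) (Q w) (R m w - w)
            have h10 : ‖Q w‖ * ‖R m w - w‖ ≤ ‖w‖ * ‖R m w - w‖ := by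
              gcongr; exact norm_proj_le _ _
            linarith [neg_abs_le (inner ℂ (Q w) (R m w - w)).re]
          have h11 : -(‖w‖ * ‖R m w - w‖) ≤ (inner ℂ (Q w) (R m w)).re := by
            linarith [sq_nonneg ‖Q w‖]
          have h12 := mul_le_mul_of_nonneg_left h11 (sq_nonneg s)
          simp only [map_add, map_smul, inner_add_left, inner_add_right, inner_smul_left,
            inner_smul_right, inner_sub_right, Complex.conj_ofReal, Complex.add_re,
            Complex.re_ofReal_mul, Complex.sub_re, Function.comp_apply, hQ, inner_proj] at h12 ⊢
          linarith) hlim hσ hB hσB ha1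
    refine ⟨x, hclosure ?_ x hx, hx1, hx2⟩
    rintro u (rfl | hu)
    · exact Submodule.zero_mem _
    · exact hu.1
  -- Here ‖Q w‖² ≤ ‖Q w‖ ‖R_m w - w‖ eventually, so Q w → 0. Replacing w by w - Q w keeps all
  -- partial sums orthogonal to `inter M A`, where the form is zero.
  · have hQ0 : Tendsto (fun w => Q w) (approxFixed M) (𝓝 0) := by
      refine squeeze_zero_norm' ?_ (by simpa using (hF.tendsto_sub m).norm)
      filter_upwards [not_frequently.1 hcase] with w hw
      rw [hQR] at hw
      have h8 := Complex.abs_re_le_norm (inner ℂ (Q w) (R m w - w))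
      have h9 := norm_inner_le_norm (𝕜 := ℂ) (Q w) (R m w - w)
      have h10 := neg_abs_le (inner ℂ (Q w) (R m w - w)).re
      by_contra! hlt
      have h11 : 0 ≤ ‖R m w - w‖ := norm_nonneg _
      nlinarith
    have hF' : IsApproxFixed R (map (fun w => w - Q w) (approxFixed M)) := by
      refine ⟨?_, fun v => ?_, fun n => ?_⟩
      · rw [tendsto_map'_iff]
        have h1 : Tendsto (fun w => ‖w - Q w‖ - ‖w‖) (approxFixed M) (𝓝 0) := by
          refine squeeze_zero_norm (fun w => ?_) (by simpa using hQ0.norm)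
          have := abs_norm_sub_norm_le (w - Q w) w
          rwa [sub_sub_cancel_left, norm_neg] at this
        simpa [Function.comp_def] using h1.add hF.tendsto_norm
      · rw [tendsto_map'_iff]
        have h1 := (hF.tendsto_inner v).sub (hQ0.inner (tendsto_const_nhds (x := v)) (𝕜 := ℂ))
        simpa [Function.comp_def, inner_sub_left] using h1
      · rw [tendsto_map'_iff]
        have h1 := ((hF.tendsto_sub n).sub (((R n).continuous.tendsto 0).comp hQ0)).add hQ0
        simp only [Function.comp_def, map_zero, sub_zero, add_zero] at h1
        refine h1.congr fun w => ?_
        simp only [Function.comp_def, map_sub]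
        abel
    obtain ⟨x, hx, hx1, hx2⟩ := hF'.exists_slow (U := (inter M A).toSubmoduleᗮ)
      (Submodule.zero_mem _) hR (fun u hu => hlow u (by rw [hQ, proj_eq_zero hu]; simp))
      (fun u hu s hs => by
        refine Eventually.frequently (eventually_map.2 (Eventually.of_forall fun w => ?_))
        exact Submodule.add_mem _ hu (Submodule.smul_mem _ _ (sub_proj_mem _ w)))
      hlim hσ hB hσB ha1
    exact ⟨x, hclosure (fun u hu => mem_orthogonal_iInf_of_mem_inter hu) x hx, hx1, hx2⟩

theorem aschRandom (hN : 2 ≤ N) (hc : friedrichsNumber M = 1) : ASCHRandom M := by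
  intro ε hε a ha hlim i
  have hbdd : BddAbove (Set.range a) := hlim.bddAbove_range
  have hσ : 0 < ⨆ n, a n := (ha 0).trans_le (le_ciSup hbdd 0)
  have hs := Real.sqrt_pos.2 hσ
  obtain ⟨x, hx, hx1, hx2⟩ := exists_slow_randomProduct hN hc i hlim hσ
    (B := √(⨆ n, a n) + ε) (by positivity) (by nlinarith [Real.sq_sqrt hσ.le])
    (le_ciSup hbdd)
  refine ⟨x, hx1, fun n _ => ?_⟩
  rw [proj_eq_zero hx, sub_zero]
  exact hx2 n

theorem randomProduct_eq_word_range (i : ℕ → Fin N) (n : ℕ) :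
    randomProduct M i n = word M ((List.range n).map i).reverse := by
  induction n with
  | zero => rfl
  | succ n ih =>
    ext x
    rw [List.range_succ, List.map_append, List.reverse_append]
    simp only [List.map_cons, List.map_nil, List.reverse_cons, List.reverse_nil, List.nil_append,
      List.cons_append, word_cons, ← ih]
    rfl

theorem randomProduct_periodic [NeZero N] (n : ℕ) :
    randomProduct M (fun k => Fin.ofNat N k) (n * N) = cyclicProduct M ^ n := by
  induction n with
  | zero => rw [Nat.zero_mul]; rfl
  | succ n ih =>
    rw [pow_succ', ← ih, Nat.succ_mul]
    ext x
    rw [randomProduct_eq_word_range, randomProduct_eq_word_range, List.range_add,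
      List.map_append, List.reverse_append, word_append, cyclicProduct_eq_word,
      mul_apply_eq_comp]
    congr 3
    apply List.ext_getElem
    · simp
    · intro k h1 h2
      have : k < N := by simpa using h1
      simp [Fin.ofNat, Nat.mod_eq_of_lt this]

/-- The cyclic product is the random product with periodic indices, sampled at multiples of `N`; `a`
is stretched accordingly. -/
theorem ASCHRandom.asch [NeZero N] (h : ASCHRandom M) :
    ASCH (cyclicProduct M) (proj (⨅ j, M j)) := by
  intro ε hε a ha hlim
  have hN : 0 < N := Nat.pos_of_neZero N
  -- For `m < N` the quotient 0 is sent to 1 by `toPNat'`, so the stretched sequence takes only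
  -- values of `a` and has the same supremum.
  let φ : ℕ → ℕ+ := fun m => (m / N).toPNat'
  have hφ : ∀ n : ℕ+, φ (n * N) = n := by
    intro n
    simp [φ, Nat.mul_div_cancel _ hN]
  have hφlim : Tendsto φ atTop atTop := by
    refine tendsto_atTop.2 fun b => ?_
    filter_upwards [eventually_ge_atTop (b * N)] with m hm
    have h1 : (b : ℕ) ≤ m / N := (Nat.le_div_iff_mul_le hN).2 hm
    rw [← PNat.coe_le_coe, Nat.toPNat'_coe, if_pos (b.pos.trans_le h1)]
    exact h1
  have hsurj : Function.Surjective φ := fun n => ⟨n * N, hφ n⟩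
  obtain ⟨x, hx, hx1⟩ := h ε hε (fun m => a (φ m)) (fun m => ha _) (hlim.comp hφlim)
    (fun k => Fin.ofNat N k)
  rw [hsurj.iSup_comp] at hx
  refine ⟨x, hx, fun n => ?_⟩
  have h1 := hx1 (n * N) (Nat.mul_pos n.pos hN)
  rw [hφ, randomProduct_periodic] at h1
  exact h1.le

end Random

end AltProj

theorem mainTheorem2 {H : Type u} [NormedAddCommGroup H] [InnerProductSpace ℂ H]
    [CompleteSpace H] (N : ℕ) (hN : 2 ≤ N) (M : Fin N → ClosedSubmodule ℂ H) :
    (AltProj.friedrichsNumber M < 1 →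
      Tendsto (fun n : ℕ => AltProj.cyclicProduct M ^ n) atTop (𝓝 (AltProj.proj (⨅ j, M j))) ∧
      ∀ n : ℕ, 1 ≤ n →
        ‖AltProj.cyclicProduct M ^ n - AltProj.proj (⨅ j, M j)‖ ≤
          (1 - ((1 - AltProj.friedrichsNumber M) / (4 * (N : ℝ))) ^ 2) ^ ((n : ℝ) / 2)) ∧
    (AltProj.friedrichsNumber M = 1 →
      (∀ x : H, Tendsto (fun n : ℕ => (AltProj.cyclicProduct M ^ n) x) atTop
        (𝓝 (AltProj.proj (⨅ j, M j) x))) ∧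
      AltProj.ASC1 (AltProj.cyclicProduct M) (AltProj.proj (⨅ j, M j)) ∧
      AltProj.ASC2 (AltProj.cyclicProduct M) (AltProj.proj (⨅ j, M j)) ∧
      AltProj.ASC3.{u, v} (AltProj.cyclicProduct M) (AltProj.proj (⨅ j, M j)) ∧
      AltProj.ASCH (AltProj.cyclicProduct M) (AltProj.proj (⨅ j, M j)) ∧
      AltProj.ASCHRandom M) := by
  have hl : ∀ j, j ∈ (List.finRange N).reverse := fun j => by simp
  have hlen : (List.finRange N).reverse.length = N := by simp
  refine ⟨fun hc => ?_, fun hc => ?_⟩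
  · rw [AltProj.cyclicProduct_eq_word]
    exact ⟨AltProj.tendsto_word_pow hN hc hl hlen,
      fun n hn => AltProj.norm_word_pow_sub_proj_le hN hc.le hl hlen hn⟩
  · have : NeZero N := ⟨by omega⟩
    have hlim : ∀ x : H, Tendsto (fun n : ℕ => (AltProj.cyclicProduct M ^ n) x) atTop
        (𝓝 (AltProj.proj (⨅ j, M j) x)) := fun x => by
      rw [AltProj.cyclicProduct_eq_word]
      exact AltProj.tendsto_word_pow_apply hl x
    have hR := AltProj.aschRandom hN hc
    have hH := hR.asch
    exact ⟨hlim, hH.asc1, hH.asc1.asc2 hlim, hH.asc3, hH, hR⟩
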